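/- Let $G$ be a simple undirected graph, let $k\ge 0$ be an integer, let $c$ be a coloring of $V(G)$ (an arbitrary map into a set of colors), and let $K$ be a field of characteristic $2$. **Definitions.** A *labeled walk* of length $\ell$ is a pair $W=((v_1,\dots,v_\ell),(r_1,\dots,r_\ell))$ with $v_iv_{i+1}\in E(G)$ for $1\le i<\ell$ and $r_i\in\{0,1,\dots,k\}$; the index $i$ is *labeled* if $r_i\ne 0$. A *labeled digon* of $W$ is a labeled index $i$ with $1<i<\ell$ and $v_{i-1}=v_{i+1}$. A *labeled walkage* is a tuple $\mathcal W=(W^1,\dots,W^p)$ of labeled walks $W^i=((v^i_1,\dots,v^i_{\ell_i}),(r^i_1,\dots,r^i_{\ell_i}))$ of lengths $\ell_i\ge 1$. Its length is $\sum_i\ell_i$, its tuple of starting vertices is $\mathtt{start}(\mathcal W)=(v^1_1,\dots,v^p_1)$, its set of ending vertices is $\mathcal T(\mathcal W)=\{v^i_{\ell_i}\mid 1\le i\le p\}$, its set of edges is $E(\mathcal W)=\{v^i_jv^i_{j+1}\}$, and its set of collected vertices is $R(\mathcal W)=\{v^i_j\mid r^i_j\neq 0\}$. It is a *labeled linkage*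 if every vertex occurs in it at most once. The walkage $\mathcal W$ is *proper* if each label from $\{1,\dots,k\}$ appears in it at most once, no walk of it contains a labeled digon, its ending vertices $v^1_{\ell_1},\dots,v^p_{\ell_p}$ are pairwise distinct, and $|c(R(\mathcal W))|=|\{(i,j)\mid r^i_j\ne 0\}|$. It is *barren* if there is no labeled linkage $\mathcal W'$ with $\mathtt{start}(\mathcal W')=\mathtt{start}(\mathcal W)$, $\mathcal T(\mathcal W')=\mathcal T(\mathcal W)$, $R(\mathcal W')=R(\mathcal W)$, $E(\mathcal W')\subseteq E(\mathcal W)$ and length at most that of $\mathcal W$. In the polynomial ring over $K$ with a variable $f_e(uv)$ for every edge $uv$, a variable $f_v(v)$ for every vertex $v$, and a variable $f_c(x,y)$ for every color $x$ and label $y\in\{1,\dots,k\}$, put $$f(\mathcal W)=\prod_{i=1}^{p}\Bigl(\prod_{j=1}^{\ell_i-1}f_e(v^i_jv^i_{j+1})\cdot\prod_{j\,:\,r^i_j\ne0}f_v(v^i_j)\,f_c(c(v^i_j),r^i_j)\Bigr).$$ **Lemma.** Let $\mathcal B$ be the set of all proper barren labeled walkages in $G$. There is a function $\phi:\mathcal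 B\to\mathcal B$ such that for all $\mathcal W\in\mathcal B$: 1. $\phi(\phi(\mathcal W))=\mathcal W$; 2. $\phi(\mathcal W)\ne\mathcal W$; 3. $f(\phi(\mathcal W))=f(\mathcal W)$; 4. $\mathcal T(\phi(\mathcal W))=\mathcal T(\mathcal W)$; 5. $\mathtt{start}(\phi(\mathcal W))=\mathtt{start}(\mathcal W)$. Consequently, for every finite family $\mathcal F\subseteq\mathcal B$ with $\phi(\mathcal F)\subseteq\mathcal F$, the polynomial $\sum_{\mathcal W\in\mathcal F}f(\mathcal W)$ is zero. -/

import Mathlib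

/-- A labeled walk in `G` with labels from `[0, k]`: its successive entries are the pairs
`(v_i, r_i)` of a vertex and a label (`0` means "unlabeled"), and consecutive vertices are
adjacent. The length is the number of vertices; the empty walk is allowed. -/
@[ext]
structure LabeledWalk {V : Type*} (G : SimpleGraph V) (k : ℕ) where
  entries : List (V × Fin (k + 1))
  isWalk : entries.IsChain (fun x y => G.Adj x.1 y.1)

namespace LabeledWalk

variable {V : Type*} {G : SimpleGraph V} {k : ℕ}

/-- The number of vertices, counted with repetition. -/
def length (W : LabeledWalk G k) : ℕ := W.entries.length

/-- The sequence `v_1, …, v_ℓ`. -/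
def vertices (W : LabeledWalk G k) : List V := W.entries.map Prod.fst

/-- The sequence `v_1 v_2, …, v_{ℓ-1} v_ℓ` of unordered pairs, with repetitions. -/
def edgeList (W : LabeledWalk G k) : List (Sym2 V) :=
  List.zipWith (fun u v => s(u, v)) W.vertices W.vertices.tail

/-- The entries at labeled indices. -/
def labeledEntries (W : LabeledWalk G k) : List (V × Fin (k + 1)) :=
  W.entries.filter (fun x => x.2 ≠ 0)

/-- The (zero-based) index `i` is a digon: it is neither the first nor the last one, and
the vertices just before and just after it coincide. -/
def IsDigon (W : LabeledWalk G k) (i : ℕ) : Prop :=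
  ∃ (_ : 0 < i) (_ : i + 1 < W.entries.length), (W.entries[i - 1]).1 = (W.entries[i + 1]).1

/-- The index `i` is a digon and is labeled. -/
def IsLabeledDigon (W : LabeledWalk G k) (i : ℕ) : Prop :=
  W.IsDigon i ∧ ∃ _ : i < W.entries.length, (W.entries[i]).2 ≠ 0

end LabeledWalk

/-- A labeled walkage: a finite tuple of nonempty labeled walks. -/
@[ext]
structure LabeledWalkage {V : Type*} (G : SimpleGraph V) (k : ℕ) where
  walks : List (LabeledWalk G k)
  nonempty : ∀ W ∈ walks, 1 ≤ W.length

/-- The variables of the polynomial ring: one for each edge, for each vertex, and for each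
color-label pair. (Those of non-edges and of the label `0` never occur in a monomial.) -/
inductive WalkVar (V C : Type*) (k : ℕ) where
  | edge (e : Sym2 V)
  | vertex (v : V)
  | colorLabel (x : C) (r : Fin (k + 1))

namespace LabeledWalk

variable {V C : Type*} {G : SimpleGraph V} {k : ℕ}

/-- The monomial `∏ f_e(v_i v_{i+1}) · ∏_{r_i ≠ 0} f_v(v_i) f_c(c(v_i), r_i)`. -/
noncomputable def monomial (K : Type*) [CommSemiring K] (c : V → C) (W : LabeledWalk G k) :
    MvPolynomial (WalkVar V C k) K :=
  (W.edgeList.map (fun e => MvPolynomial.X (WalkVar.edge e))).prod *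
    (W.labeledEntries.map (fun x =>
      MvPolynomial.X (WalkVar.vertex x.1) * MvPolynomial.X (WalkVar.colorLabel (c x.1) x.2))).prod

end LabeledWalk

namespace LabeledWalkage

variable {V C : Type*} {G : SimpleGraph V} {k : ℕ}

/-- The total length `∑ ℓ_i`. -/
def length (W : LabeledWalkage G k) : ℕ := (W.walks.map LabeledWalk.length).sum

/-- The tuple of starting vertices (one for each walk, as the walks are nonempty). -/
def start (W : LabeledWalkage G k) : List V := W.walks.filterMap (fun w => w.vertices.head?)

/-- The tuple of last vertices of the walks (one for each walk, as the walks are nonempty). -/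
def endTuple (W : LabeledWalkage G k) : List V :=
  W.walks.filterMap (fun w => w.vertices.getLast?)

/-- The set of ending vertices. -/
def endSet (W : LabeledWalkage G k) : Set V := {v | v ∈ W.endTuple}

/-- The set of edges. -/
def edgeSet (W : LabeledWalkage G k) : Set (Sym2 V) := {e | ∃ w ∈ W.walks, e ∈ w.edgeList}

/-- All entries of all the walks at labeled indices, one for each labeled index `(i, j)`. -/
def labeledEntries (W : LabeledWalkage G k) : List (V × Fin (k + 1)) :=
  W.walks.flatMap LabeledWalk.labeledEntries

/-- The set of collected vertices, i.e. those that occur at a labeled index. -/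
def collected (W : LabeledWalkage G k) : Set V := {v | ∃ x ∈ W.labeledEntries, x.1 = v}

/-- Each label from `[k]` appears at most once. -/
def IsInjective (W : LabeledWalkage G k) : Prop := (W.labeledEntries.map Prod.snd).Nodup

/-- Every vertex occurs at most once: the walks are vertex-disjoint paths. -/
def IsLinkage (W : LabeledWalkage G k) : Prop := (W.walks.flatMap LabeledWalk.vertices).Nodup

/-- Injective, without labeled digons, and with distinct ending vertices. -/
structure IsSemiproper (W : LabeledWalkage G k) : Prop where
  injective : W.IsInjective
  no_labeledDigon : ∀ w ∈ W.walks, ∀ i, ¬ w.IsLabeledDigon i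
  ends_distinct : W.endTuple.Nodup

/-- Semiproper, and `|c(R(W))|` equals the number of labeled indices `(i, j)`. -/
structure IsProper (c : V → C) (W : LabeledWalkage G k) : Prop extends IsSemiproper W where
  colors_distinct : (c '' W.collected).ncard = W.labeledEntries.length

/-- There is no labeled linkage with the same starting tuple, set of ending vertices and set of
collected vertices, with no greater length, and using only edges of `W`. -/
def IsBarren (W : LabeledWalkage G k) : Prop :=
  ¬ ∃ W' : LabeledWalkage G k, W'.IsLinkage ∧ W'.start = W.start ∧ W'.endSet = W.endSet ∧
    W'.collected = W.collected ∧ W'.length ≤ W.length ∧ W'.edgeSet ⊆ W.edgeSet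

/-- The monomial of a labeled walkage: the product of the monomials of its walks. -/
noncomputable def monomial (K : Type*) [CommSemiring K] (c : V → C) (W : LabeledWalkage G k) :
    MvPolynomial (WalkVar V C k) K :=
  (W.walks.map (LabeledWalk.monomial K c)).prod

/-- The set of all proper barren labeled walkages in `G`, of every order and length. -/
def properBarren (G : SimpleGraph V) (k : ℕ) (c : V → C) : Set (LabeledWalkage G k) :=
  {W | W.IsProper c ∧ W.IsBarren}

end LabeledWalkage

/-!
# Cancellation of proper barren labeled walkages in characteristic two

Being proper and barren depends, among walkages without labeled digons and with distinct ends, only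
on the monomial, the tuple of starts and the set of ends. Hence the required involution exists as
soon as every class of proper barren walkages with the same such data (`LabeledWalkage.fiber`) is
finite and has an even number of elements. The involution is not constructed by rerouting walks: the
parity of the class is computed with determinants over a ring of characteristic two.

Fix a proper barren walkage with monomial of exponent `m`, and work in `TruncPoly K m`, the
polynomial ring modulo the monomials that do not divide this one. Write `x v w` for the variable of
an edge and `z v` for the sum of the label weights of `v`. The total weight of the visits to `v`
with any label is `1 + z v`, and `z v ^ 2 = 0` because `v` is collected at most once. As in the
proofs of the Ihara-Bass formula, the steps that return along the edge just used can be eliminated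
from the recursion for the sums over walks without labeled digons. The matrix `Q` of these sums is
therefore the inverse of an explicit *symmetric* matrix `N` (`walkMatrix`), with entries
`1 + z v + ∑ u, x v u ^ 2 * z u` on the diagonal and `x v w + x v w ^ 3 * z v * z w` off it
(`walkMatrix_mul_walkResolvent`). The coefficient at `m` of the minor of `Q` with rows the starts
and columns the ends is the size of the class modulo two (`topCoeff_det_walkResolvent`,
`LabeledWalkage.image_entriesTuple_fiber`).

Up to the factor `det Q` this minor is `det N` with the row of each end replaced by the unit vector
at the matching start (`det_minor_eq_det_replaceRows_mul`). Expanding further rows along the paths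
that emerge from the starts writes it as a sum over linkages `L` of a product of entries of `N`
along `L` times `det N_L`, where `N_L` is `N` with the vertices of `L` isolated. For a vertex `v`
outside `L` consider the Euler derivation `D` at `z v`. By Jacobi's formula and the symmetry of `N`,
only diagonal entries contribute to the derivatives of these determinants in characteristic two, and
`D (det N_L) = z v * N v v * det N_L` with a logarithmic derivative that does not depend on `L`
(`Derivation.map_det_isolate_walkMatrix`). So the contribution `c * det N_L / det N` of `L` is a
constant of `D`, and its coefficient at `m` vanishes if `v` is collected. If the class were odd,
some linkage along edges of the walkage would thus pass through all collected vertices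
(`exists_isRouting_of_replaceRows_ne_zero`), and the walkage would not be barren
(`LabeledWalkage.not_isBarren_of_isRouting`).
-/

/-! ### Determinants of symmetric matrices in characteristic two -/

theorem Finset.exists_perm_of_injOn {α : Type*} [Finite α] [DecidableEq α] {A : Finset α}
    {g : α → α} (hg : ∀ a ∈ A, g a ∈ A) (hinj : Set.InjOn g A) :
    ∃ σ : Equiv.Perm α, (∀ a ∈ A, σ a = g a) ∧ ∀ a ∉ A, σ a = a := by
  have hi : Function.Injective (fun i => if i ∈ A then g i else i) := by
    intro i j h
    by_cases hiA : i ∈ A <;> by_cases hjA : j ∈ A <;> simp only [hiA, hjA, if_true, if_false] at h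
    · exact hinj hiA hjA h
    · exact absurd (h ▸ hg i hiA) hjA
    · exact absurd (h ▸ hg j hjA) hiA
    · exact h
  exact ⟨Equiv.ofBijective _ (Finite.injective_iff_bijective.mp hi), fun a ha => if_pos ha,
    fun a ha => if_neg ha⟩

section Determinants

open Matrix

variable {n R : Type*} [DecidableEq n] [CommRing R]

/-- The matrix `N` with the row `a` replaced by the unit vector at `g a`, for all `a ∈ A`. -/
def replaceRows (N : Matrix n n R) (A : Finset n) (g : n → n) : Matrix n n R :=
  of fun i j => if i ∈ A then (if j = g i then 1 else 0) else N i j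

/-- The matrix `N` with the rows and columns in `A` replaced by those of the identity. -/
def isolate (N : Matrix n n R) (A : Finset n) : Matrix n n R :=
  of fun i j => if i ∈ A ∨ j ∈ A then (if i = j then 1 else 0) else N i j

theorem isolate_isSymm {N : Matrix n n R} (hN : N.IsSymm) (A : Finset n) :
    (isolate N A).IsSymm := by
  ext i j
  simp only [isolate, transpose_apply, of_apply, or_comm (a := j ∈ A), eq_comm (a := j),
    hN.apply i j]

theorem Derivation.map_finset_prod {A ι : Type*} [CommRing A] [Algebra A R] [DecidableEq ι]
    (D : Derivation A R R) (s : Finset ι) (f : ι → R) :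
    D (∏ i ∈ s, f i) = ∑ i ∈ s, (∏ j ∈ s.erase i, f j) * D (f i) := by
  induction s using Finset.induction_on with
  | empty => simp
  | insert a s ha ih =>
    rw [Finset.prod_insert ha, D.leibniz, ih, Finset.sum_insert ha, Finset.erase_insert ha,
      add_comm, smul_eq_mul, smul_eq_mul, Finset.mul_sum, add_right_inj]
    refine Finset.sum_congr rfl fun i hi => ?_
    have hia : a ≠ i := fun h => ha (h ▸ hi)
    rw [Finset.erase_insert_of_ne hia, Finset.prod_insert (by simp [ha])]
    ring

variable [Fintype n]

/-- Jacobi's formula for the derivative of a determinant. -/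
theorem Derivation.map_det {A : Type*} [CommRing A] [Algebra A R] (D : Derivation A R R)
    (M : Matrix n n R) : D M.det = ∑ i, ∑ j, M.adjugate i j * D (M j i) := by
  have key : ∀ i, ∑ j, M.adjugate i j * D (M j i) =
      (M.updateCol i (fun j => D (M j i))).det := by
    intro i
    rw [← cramer_apply, cramer_eq_adjugate_mulVec]
    rfl
  simp_rw [key, det_apply']
  rw [map_sum, Finset.sum_comm]
  refine Finset.sum_congr rfl fun σ _ => ?_
  rw [D.leibniz, Derivation.map_finset_prod, D.map_intCast, smul_zero, add_zero, smul_eq_mul,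
    Finset.mul_sum]
  refine Finset.sum_congr rfl fun i _ => ?_
  congr 1
  rw [← Finset.mul_prod_erase _ _ (Finset.mem_univ i), mul_comm]
  congr 1
  · simp
  · refine Finset.prod_congr rfl fun j hj => ?_
    rw [updateCol_ne (Finset.ne_of_mem_erase hj)]

theorem sum_sum_eq_sum_diag_of_symm [CharP R 2] (S : n → n → R) (hS : ∀ i j, S i j = S j i) :
    ∑ i, ∑ j, S i j = ∑ i, S i i := by
  rw [← Finset.sum_product', ← Finset.diag_union_offDiag,
    Finset.sum_union (Finset.disjoint_diag_offDiag _), Finset.sum_diag, add_eq_left]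
  refine Finset.sum_involution (fun p _ => p.swap) ?_ ?_ ?_ ?_
  · intro p _
    simp only [Prod.fst_swap, Prod.snd_swap]
    rw [hS p.2 p.1, CharTwo.add_self_eq_zero]
  · rintro ⟨i, j⟩ h _ h'
    simp only [Finset.mem_offDiag] at h
    exact h.2.2 (congrArg Prod.fst h').symm
  · rintro ⟨i, j⟩ h
    simpa [eq_comm] using h
  · simp

/-- In characteristic two, only the diagonal of a symmetric matrix contributes to the derivative of
its determinant, and `M * adj M * M = det M • M` evaluates that contribution when the diagonal
varies along the squares of the entries of the row `v`. -/
theorem Derivation.map_det_of_isSymm [CharP R 2] {A : Type*} [CommRing A] [Algebra A R]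
    (D : Derivation A R R) (M : Matrix n n R) (hM : M.IsSymm) (v : n) (ζ : R)
    (hD : ∀ w, D (M w w) = ζ * M v w ^ 2) :
    D M.det = ζ * M v v * M.det := by
  have hA : M.adjugate.IsSymm := hM.adjugate
  rw [D.map_det, sum_sum_eq_sum_diag_of_symm]
  · have h1 : (M * M.adjugate * M) v v = ∑ w, M.adjugate w w * M v w ^ 2 := by
      rw [mul_apply]
      simp_rw [mul_apply, Finset.sum_mul]
      rw [sum_sum_eq_sum_diag_of_symm]
      · refine Finset.sum_congr rfl fun w _ => ?_
        rw [hM.apply v w]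
        ring
      · intro i j
        rw [hM.apply v i, hM.apply v j, hA.apply i j]
        ring
    have h2 : (M * M.adjugate * M) v v = M.det * M v v := by
      rw [mul_adjugate, smul_mul, one_mul]
      rfl
    simp_rw [hD]
    rw [mul_assoc, mul_comm (M v v), ← h2, h1, Finset.mul_sum]
    refine Finset.sum_congr rfl fun w _ => by ring
  · intro i j
    rw [hA.apply i j, hM.apply i j]

theorem det_replaceRows_expand (N : Matrix n n R) {A : Finset n} (g : n → n) {a : n}
    (ha : a ∉ A) :
    (replaceRows N A g).det =
      ∑ w, N a w * (replaceRows N (insert a A) (Function.update g a w)).det := by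
  have h1 : ∀ w, replaceRows N (insert a A) (Function.update g a w) =
      (replaceRows N A g).updateRow a (Pi.single w 1) := by
    intro w
    ext i j
    by_cases hi : i = a
    · subst hi
      simp [replaceRows, Pi.single_apply]
    · simp [replaceRows, hi]
  have h2 : replaceRows N A g = (replaceRows N A g).updateRow a (∑ w, N a w • Pi.single w 1) := by
    rw [eq_comm]
    convert updateRow_eq_self (replaceRows N A g) a
    ext j
    simp [replaceRows, ha, Pi.single_apply, Finset.sum_apply]
  conv_lhs => rw [h2]
  rw [← cramer_transpose_apply, map_sum, Finset.sum_apply]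
  refine Finset.sum_congr rfl fun w _ => ?_
  rw [map_smul, h1, ← cramer_transpose_apply]
  rfl

theorem det_replaceRows_eq_zero (N : Matrix n n R) {A : Finset n} {g : n → n} {a b : n}
    (ha : a ∈ A) (hb : b ∈ A) (hab : a ≠ b) (hg : g a = g b) : (replaceRows N A g).det = 0 := by
  apply det_zero_of_row_eq hab
  ext j
  simp [replaceRows, ha, hb, hg]

theorem det_replaceRows_of_perm [CharP R 2] (N : Matrix n n R) {A : Finset n} {g : n → n}
    (hg : ∀ a ∈ A, g a ∈ A) (hinj : Set.InjOn g A) :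
    (replaceRows N A g).det = (isolate N A).det := by
  obtain ⟨σ, hσA, hσ⟩ := Finset.exists_perm_of_injOn hg hinj
  have hσ : replaceRows N A g = (replaceRows N A id).submatrix σ id := by
    ext i j
    by_cases hiA : i ∈ A
    · simp [replaceRows, hσA i hiA, hiA, hg i hiA]
    · simp [replaceRows, hσ i hiA, hiA]
  have hsign : ((Equiv.Perm.sign σ : ℤ) : R) = 1 := by
    rcases Int.units_eq_one_or (Equiv.Perm.sign σ) with h | h <;> simp [h, CharTwo.neg_eq]
  rw [hσ, det_permute, hsign, one_mul, twoBlockTriangular_det' _ (· ∈ A),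
    twoBlockTriangular_det' (isolate N A) (· ∈ A)]
  · congr 2
    · ext i j
      have hij : (j : n) = i ↔ (i : n) = j := eq_comm
      simp [toSquareBlockProp, replaceRows, isolate, i.2, hij]
    · ext i j
      simp [toSquareBlockProp, replaceRows, isolate, i.2, j.2]
  · intro i hi j hj
    have : i ≠ j := fun h => hj (h ▸ hi)
    simp [isolate, hi, this]
  · intro i hi j hj
    have : j ≠ i := fun h => hj (h ▸ hi)
    simp [replaceRows, hi, this]

/-- A minor of the inverse `Q` of `N` is, up to the factor `det Q`, the determinant of `N` with some
rows replaced by unit vectors. -/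
theorem det_minor_eq_det_replaceRows_mul {ι : Type*} [Fintype ι] [DecidableEq ι]
    {N Q : Matrix n n R} (hNQ : N * Q = 1) (s t : ι → n) (ht : Function.Injective t) (g : n → n)
    (hg : ∀ j, g (t j) = s j) {T : Finset n} (hT : ∀ v, v ∈ T ↔ ∃ j, t j = v) :
    (Q.submatrix s t).det = (replaceRows N T g).det * Q.det := by
  have hBQ : ∀ i j, (replaceRows N T g * Q) i j =
      if i ∈ T then Q (g i) j else if i = j then 1 else 0 := by
    intro i j
    rw [mul_apply]
    by_cases hi : i ∈ T
    · simp only [replaceRows, of_apply, if_pos hi, ite_mul, one_mul, zero_mul,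
        Finset.sum_ite_eq', Finset.mem_univ, if_true]
    · simp only [replaceRows, of_apply, if_neg hi]
      rw [← mul_apply, hNQ, one_apply]
  have h2 : (toSquareBlockProp (replaceRows N T g * Q) fun i => ¬ i ∈ T) = 1 := by
    ext i j
    rw [toSquareBlockProp_def, of_apply, hBQ, if_neg i.2, one_apply]
    simp only [Subtype.ext_iff]
  let e : ι ≃ {i // i ∈ T} := Equiv.ofBijective (fun j => ⟨t j, (hT _).mpr ⟨j, rfl⟩⟩)
    ⟨fun a b h => ht (congrArg Subtype.val h), fun ⟨i, hi⟩ => by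
      obtain ⟨j, rfl⟩ := (hT i).mp hi
      exact ⟨j, rfl⟩⟩
  have h3 : (toSquareBlockProp (replaceRows N T g * Q) (· ∈ T)).submatrix e e =
      Q.submatrix s t := by
    ext i j
    rw [submatrix_apply, toSquareBlockProp_def, of_apply, hBQ, if_pos (e i).2, submatrix_apply]
    exact congrArg (fun a => Q a (t j)) (hg i)
  rw [← det_mul, twoBlockTriangular_det _ (· ∈ T), h2, det_one, mul_one, ← h3]
  · convert det_submatrix_equiv_self e _
  · intro i hi j hj
    have : i ≠ j := fun h => hi (h ▸ hj)
    rw [hBQ, if_neg hi, if_neg this]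

end Determinants

/-! ### The inverse of the matrix of walk sums -/

section WalkMatrix

open Matrix

variable {V R : Type*} [DecidableEq V] [Fintype V] [CommRing R]

/-- The symmetric matrix inverse to the matrix of sums over walks without labeled digons, for edge
weights `x` and label weights `z` of square zero. -/
def walkMatrix (x : V → V → R) (z : V → R) : Matrix V V R :=
  of fun v w => if v = w then 1 + z v + ∑ u, x v u ^ 2 * z u
    else x v w + x v w ^ 3 * (z v * z w)

theorem walkMatrix_isSymm {x : V → V → R} (hx : ∀ v w, x v w = x w v) (z : V → R) :
    (walkMatrix x z).IsSymm := by
  ext v w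
  by_cases h : v = w
  · subst h
    rfl
  · simp only [walkMatrix, transpose_apply, of_apply, if_neg h, if_neg (Ne.symm h), hx w v,
      mul_comm (z w)]

theorem CharTwo.mul_one_add_sq [CharP R 2] {a b : R} (h : b ^ 2 = 0) :
    (a * (1 + b)) ^ 2 = a ^ 2 := by
  rw [mul_pow, CharTwo.add_sq, h, one_pow, add_zero, mul_one]

/-- Sums over the walks with `n` steps from `v` to `t`, without labeled digons, that are preceded
by the vertex `u`. -/
def walkSum (x : V → V → R) (z : V → R) (t : V) : ℕ → V → V → R
  | 0, _, v => if v = t then 1 + z v else 0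
  | n + 1, u, v => ∑ w, x v w * (1 + if u = w then 0 else z v) * walkSum x z t n v w

theorem walkSum_mem_pow {x : V → V → R} (z : V → R) (t : V) {J : Ideal R}
    (hx : ∀ v w, x v w ∈ J) (n : ℕ) (u v : V) : walkSum x z t n u v ∈ J ^ n := by
  induction n generalizing u v with
  | zero => simp
  | succ n ih =>
    rw [walkSum]
    refine Ideal.sum_mem _ fun w _ => ?_
    rw [mul_assoc, pow_succ', mul_comm (1 + _)]
    exact Ideal.mul_mem_mul (hx v w) (Ideal.mul_mem_right _ _ (ih v w))

/-- Sums over the walks with at most `D` steps from `v` to `t` without labeled digons. -/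
def walkResolvent (x : V → V → R) (z : V → R) (D : ℕ) : Matrix V V R :=
  of fun v t => (if v = t then 1 + z v else 0) +
    ∑ w, x v w * (1 + z v) * ∑ n ∈ Finset.range D, walkSum x z t n v w

/-- Eliminating the sums over walks with a prescribed predecessor from their recursion leaves a
linear system for the sums over all walks; its matrix is `walkMatrix x z`. -/
theorem walkMatrix_mul_walkResolvent [CharP R 2] {x : V → V → R} (hx : ∀ v w, x v w = x w v)
    (hx0 : ∀ v, x v v = 0) {z : V → R} (hz : ∀ v, z v ^ 2 = 0) {J : Ideal R}
    (hJ : ∀ v w, x v w ∈ J) {D : ℕ} (hD : J ^ D = ⊥) :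
    walkMatrix x z * walkResolvent x z D = 1 := by
  ext v t
  set P : V → V → R := fun u v => ∑ n ∈ Finset.range D, walkSum x z t n u v with hP
  set Q : V → R := fun v => walkResolvent x z D v t with hQ
  have hQv : ∀ v, Q v = (if v = t then 1 + z v else 0) + ∑ w, x v w * (1 + z v) * P v w :=
    fun v => rfl
  have hPrec : ∀ u v, P u v = (if v = t then 1 + z v else 0) +
      ∑ w, x v w * (1 + if u = w then 0 else z v) * P v w := by
    intro u v
    have h0 : walkSum x z t D u v = 0 := by
      have := walkSum_mem_pow z t hJ D u v
      rwa [hD, Ideal.mem_bot] at this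
    have h1 : P u v = ∑ n ∈ Finset.range (D + 1), walkSum x z t n u v := by
      rw [Finset.sum_range_succ, h0, add_zero]
    rw [h1, Finset.sum_range_succ', add_comm]
    congr 1
    simp_rw [walkSum, hP, Finset.mul_sum]
    rw [Finset.sum_comm]
  -- A predecessor `u` only forbids to label `v` before a step back to `u`.
  have hPQ : ∀ u v, P u v = Q v + z v * x u v * P v u := by
    intro u v
    rw [hPrec, hQv, add_assoc]
    congr 1
    have : z v * x u v * P v u = ∑ w, if u = w then z v * x v w * P v w else 0 := by
      rw [Finset.sum_ite_eq, if_pos (Finset.mem_univ _), hx]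
    rw [this, ← Finset.sum_add_distrib]
    refine Finset.sum_congr rfl fun w _ => ?_
    by_cases h : u = w
    · rw [if_pos h, if_pos h]
      linear_combination -(CharTwo.add_self_eq_zero (z v * x v w * P v w))
    · rw [if_neg h, if_neg h, add_zero]
  -- The equations `hPQ` for `(u, v)` and `(v, u)` have determinant `1 + x u v ^ 2 * z u * z v`,
  -- which is its own inverse.
  have hPQ' : ∀ u v, P u v = Q v * (1 + x u v ^ 2 * (z u * z v)) + z v * x u v * Q u := by
    intro u v
    have h1 := hPQ u v
    have h2 := hPQ v u
    rw [hx v u] at h2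
    linear_combination (1 + x u v ^ 2 * (z u * z v)) * h1 +
      z v * x u v * (1 + x u v ^ 2 * (z u * z v)) * h2 +
      x u v ^ 4 * P u v * z u ^ 2 * hz v + x u v ^ 3 * Q u * z u * hz v
  -- Multiplying the recursion by `1 + z v` removes the label factor of the first vertex.
  have hinv : (1 + z v) * (1 + z v) = 1 := by
    have := CharTwo.mul_one_add_sq (a := (1 : R)) (hz v)
    rw [one_mul, one_pow, sq] at this
    exact this
  have hmain : (1 + z v) * Q v = (if v = t then 1 else 0) + ∑ w, x v w * P v w := by
    rw [hQv, mul_add, mul_ite, hinv, mul_zero, Finset.mul_sum]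
    congr 1
    refine Finset.sum_congr rfl fun w _ => ?_
    linear_combination (x v w * P v w) * hinv
  have hsum : ∑ w, x v w * P v w = ∑ w, (x v w + x v w ^ 3 * (z v * z w)) * Q w +
      (∑ w, x v w ^ 2 * z w) * Q v := by
    rw [Finset.sum_mul, ← Finset.sum_add_distrib]
    refine Finset.sum_congr rfl fun w _ => ?_
    rw [hPQ']
    ring
  have hoff : (walkMatrix x z * walkResolvent x z D) v t =
      (1 + z v + ∑ u, x v u ^ 2 * z u) * Q v +
        ∑ w, (x v w + x v w ^ 3 * (z v * z w)) * Q w := by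
    rw [mul_apply, ← Finset.add_sum_erase _ _ (Finset.mem_univ v),
      ← Finset.add_sum_erase (a := v) (f := fun w => (x v w + x v w ^ 3 * (z v * z w)) * Q w) _
      (Finset.mem_univ v)]
    simp only [hx0]
    congr 1
    · simp [walkMatrix, hQ]
    · rw [show ((0 : R) + 0 ^ 3 * (z v * z v)) * Q v = 0 by ring, zero_add]
      refine Finset.sum_congr rfl fun w hw => ?_
      simp [walkMatrix, (Finset.ne_of_mem_erase hw).symm, hQ]
  rw [hoff, one_apply]
  rw [hsum] at hmain
  linear_combination hmain + CharTwo.add_self_eq_zero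
    ((∑ w, (x v w + x v w ^ 3 * (z v * z w)) * Q w) + (∑ w, x v w ^ 2 * z w) * Q v)

/-- If `D` is the Euler derivation at `z v`, then the logarithmic derivative of the determinant of
`walkMatrix x z` is unchanged when vertices other than `v` are isolated. -/
theorem Derivation.map_det_isolate_walkMatrix [CharP R 2] {A : Type*} [CommRing A] [Algebra A R]
    {x : V → V → R} (hx : ∀ v w, x v w = x w v) (hx0 : ∀ v, x v v = 0) {z : V → R}
    (hz : ∀ v, z v ^ 2 = 0) (D : Derivation A R R) {v : V} (hDx : ∀ u w, D (x u w) = 0)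
    (hDz : ∀ w, D (z w) = if w = v then z v else 0) {S : Finset V} (hv : v ∉ S) :
    D (isolate (walkMatrix x z) S).det =
      z v * walkMatrix x z v v * (isolate (walkMatrix x z) S).det := by
  have hNv : isolate (walkMatrix x z) S v v = walkMatrix x z v v := by simp [isolate, hv]
  rw [← hNv]
  refine D.map_det_of_isSymm _ (isolate_isSymm (walkMatrix_isSymm hx z) S) v (z v) fun w => ?_
  by_cases hw : w ∈ S
  · have : v ≠ w := fun h => hv (h ▸ hw)
    simp [isolate, hw, this]
  · simp only [isolate, of_apply, hv, hw, or_self, if_false]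
    have hdiag : D (walkMatrix x z w w) = (if w = v then z v else 0) + x w v ^ 2 * z v := by
      simp [walkMatrix, Derivation.leibniz_pow, hDz, hDx]
    rw [hdiag]
    by_cases hwv : w = v
    · subst hwv
      have hsq : (∑ u, x w u ^ 2 * z u) ^ 2 = 0 := by
        rw [CharTwo.sum_sq]
        exact Finset.sum_eq_zero fun u _ => by rw [mul_pow, hz, mul_zero]
      simp only [walkMatrix, of_apply, if_true]
      rw [CharTwo.add_sq, CharTwo.add_sq, hsq, hz, hx0]
      ring
    · simp only [walkMatrix, of_apply, if_neg (Ne.symm hwv), if_neg hwv, zero_add, hx w v]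
      have : (x v w + x v w ^ 3 * (z v * z w)) = x v w * (1 + x v w ^ 2 * (z v * z w)) := by ring
      rw [this, CharTwo.mul_one_add_sq, mul_comm]
      linear_combination (x v w ^ 4 * z w ^ 2) * hz v

end WalkMatrix

/-! ### Routings extracted from nonzero minors -/

section Routing

open Matrix

variable {V R ι : Type*} [DecidableEq V] [CommRing R]

/-- A partial routing: a map `g` on a set `A` of vertices that leads from each sink `t j` back to
the source `s j` and from every other vertex of `A` along an edge of nonzero weight, such that `A`
is generated by the sinks under `g`. -/
structure IsPartialRouting (x : V → V → R) (s t : ι → V) (A : Finset V) (g : V → V) : Prop where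
  sink_mem : ∀ j, t j ∈ A
  map_sink : ∀ j, g (t j) = s j
  weight_ne_zero : ∀ a ∈ A, (∀ j, t j ≠ a) → x a (g a) ≠ 0
  generated : ∀ B ⊆ A, (∀ j, t j ∈ B) → (∀ b ∈ B, g b ∈ A → g b ∈ B) → A ⊆ B

/-- A routing: a partial routing that permutes its vertices. Cutting the cycles of `g` at the sinks
gives disjoint paths from the sources to the sinks that cover `A`. -/
structure IsRouting (x : V → V → R) (s t : ι → V) (A : Finset V) (g : V → V) : Prop
    extends IsPartialRouting x s t A g where
  mapsTo : ∀ a ∈ A, g a ∈ A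
  injOn : Set.InjOn g A

/-- A partial routing that leaves `A` at `a` can be continued from `a` along any edge of nonzero
weight. -/
theorem IsPartialRouting.insert_update {x : V → V → R} {s t : ι → V} {A : Finset V} {g : V → V}
    (h : IsPartialRouting x s t A g) {a b w : V} (ha : a ∉ A) (hb : b ∈ A) (hab : g b = a)
    (hw : x a w ≠ 0) : IsPartialRouting x s t (insert a A) (Function.update g a w) := by
  have hne : ∀ c ∈ A, Function.update g a w c = g c := fun c hc =>
    Function.update_of_ne (ne_of_mem_of_not_mem hc ha) _ _
  refine ⟨fun j => Finset.mem_insert_of_mem (h.sink_mem j), fun j => ?_, fun c hc hcj => ?_,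
    fun B hB htB hgB => ?_⟩
  · rw [hne _ (h.sink_mem j), h.map_sink]
  · rcases Finset.mem_insert.mp hc with rfl | hc
    · rwa [Function.update_self]
    · rw [hne c hc]
      exact h.weight_ne_zero c hc hcj
  · have hAB : A ⊆ B := by
      refine (h.generated (B ∩ A) Finset.inter_subset_right
        (fun j => Finset.mem_inter.mpr ⟨htB j, h.sink_mem j⟩) fun c hc hgc => ?_).trans
        Finset.inter_subset_left
      obtain ⟨hcB, hcA⟩ := Finset.mem_inter.mp hc
      have := hgB c hcB (by rw [hne c hcA]; exact Finset.mem_insert_of_mem hgc)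
      rw [hne c hcA] at this
      exact Finset.mem_inter.mpr ⟨this, hgc⟩
    refine Finset.insert_subset ?_ hAB
    have := hgB b (hAB hb) (by rw [hne b hb, hab]; exact Finset.mem_insert_self _ _)
    rwa [hne b hb, hab] at this

variable [Fintype V]

/-- Rows of `walkMatrix x z` are expanded one at a time along the partial routing, which ends at
routings. The term of a routing on `A` is a constant of the Euler derivation at every vertex outside
`A`, so a functional that sees only terms linear in the label weights of `S` vanishes on it unless
`S ⊆ A`. -/
theorem exists_isRouting_of_replaceRows_ne_zero [CharP R 2] {K M : Type*} [CommRing K]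
    [Algebra K R] [AddCommGroup M]
    {x : V → V → R} (hx : ∀ v w, x v w = x w v) (hx0 : ∀ v, x v v = 0)
    {z : V → R} (hz : ∀ v, z v ^ 2 = 0) {q : R} (hq : q * (walkMatrix x z).det = 1)
    {S : Set V} (D : V → Derivation K R R) (hDx : ∀ v ∈ S, ∀ u w, D v (x u w) = 0)
    (hDz : ∀ v ∈ S, ∀ w, D v (z w) = if w = v then z v else 0)
    (φ : R →+ M) (hφ : ∀ v ∈ S, ∀ f, φ (D v f) = φ f) {s t : ι → V}
    (A : Finset V) (g : V → V) (hg : IsPartialRouting x s t A g) (c : R)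
    (hc : ∀ v ∈ S, v ∉ A → (∀ b ∈ A, g b ≠ v) → D v c = 0)
    (hne : φ (q * c * (replaceRows (walkMatrix x z) A g).det) ≠ 0) :
    ∃ (A : Finset V) (g : V → V), IsRouting x s t A g ∧ S ⊆ A := by
  induction hn : (Finset.univ \ A).card using Nat.strong_induction_on generalizing A g c with
  | h n ih =>
  by_cases hinj : Set.InjOn g A
  swap
  · simp only [Set.InjOn, not_forall] at hinj
    obtain ⟨a, ha, b, hb, hab, hne'⟩ := hinj
    rw [det_replaceRows_eq_zero _ ha hb hne' hab, mul_zero, map_zero] at hne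
    exact absurd rfl hne
  by_cases hmaps : ∀ a ∈ A, g a ∈ A
  · refine ⟨A, g, ⟨hg, hmaps, hinj⟩, fun v hv => ?_⟩
    by_contra hvA
    have hvA : v ∉ A := hvA
    -- The logarithmic derivatives of `q` and of the determinant with `A` isolated cancel.
    have hDN := (D v).map_det_isolate_walkMatrix hx hx0 hz (hDx v hv) (hDz v hv) hvA
    have hDq : D v q = z v * walkMatrix x z v v * q := by
      have h1 := (D v).map_det_isolate_walkMatrix hx hx0 hz (hDx v hv) (hDz v hv)
        (Finset.notMem_empty v)
      have h2 : isolate (walkMatrix x z) ∅ = walkMatrix x z := by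
        ext i j
        simp [isolate]
      rw [h2] at h1
      rw [(D v).leibniz_of_mul_eq_one hq, h1, CharTwo.neg_eq, smul_eq_mul]
      linear_combination (q * z v * walkMatrix x z v v) * hq
    have hDc : D v c = 0 := hc v hv hvA fun b hb hbv => hvA (hbv ▸ hmaps b hb)
    rw [det_replaceRows_of_perm _ hmaps hinj, ← hφ v hv, Derivation.leibniz, Derivation.leibniz,
      hDc, hDN, hDq] at hne
    refine hne ?_
    rw [← map_zero φ]
    congr 1
    simp only [smul_eq_mul, mul_zero, zero_add]
    linear_combination CharTwo.add_self_eq_zero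
      (q * c * z v * walkMatrix x z v v * (isolate (walkMatrix x z) A).det)
  · push Not at hmaps
    obtain ⟨b, hb, hbA⟩ := hmaps
    rw [det_replaceRows_expand _ g hbA, Finset.mul_sum, map_sum] at hne
    obtain ⟨w, -, hw⟩ := Finset.exists_ne_zero_of_sum_ne_zero hne
    have hbne : b ≠ g b := fun h => hbA (h ▸ hb)
    -- For `w = g b` the rows `b` and `g b` agree, so the diagonal entry of the row has no
    -- contribution.
    have hwb : g b ≠ w := by
      intro h
      rw [det_replaceRows_eq_zero (a := b) (b := g b) _ (Finset.mem_insert_of_mem hb)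
        (Finset.mem_insert_self _ _) hbne, mul_zero, mul_zero, map_zero] at hw
      · exact hw rfl
      · rw [Function.update_of_ne hbne, Function.update_self, h]
    have hN : walkMatrix x z (g b) w = x (g b) w + x (g b) w ^ 3 * (z (g b) * z w) := by
      simp [walkMatrix, hwb]
    have hxw : x (g b) w ≠ 0 := by
      intro h
      rw [hN, h] at hw
      simp at hw
    rw [← mul_assoc, mul_assoc q] at hw
    refine ih _ ?_ _ _ (hg.insert_update hbA hb rfl hxw) _ (fun v hv hvA hgv => ?_) hw rfl
    · rw [← hn]
      refine Finset.card_lt_card (Finset.ssubset_iff_of_subset ?_ |>.mpr ⟨g b, ?_, ?_⟩)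
      · exact Finset.sdiff_subset_sdiff le_rfl (Finset.subset_insert _ _)
      · simp [hbA]
      · simp
    · have hvb : g b ≠ v := fun h => hvA (h ▸ Finset.mem_insert_self _ _)
      have hvw : w ≠ v := by
        have := hgv (g b) (Finset.mem_insert_self _ _)
        rwa [Function.update_self] at this
      have hvc : D v c = 0 := by
        refine hc v hv (fun h => hvA (Finset.mem_insert_of_mem h)) fun a ha => ?_
        have := hgv a (Finset.mem_insert_of_mem ha)
        rwa [Function.update_of_ne (ne_of_mem_of_not_mem ha hbA)] at this
      have hDN : D v (walkMatrix x z (g b) w) = 0 := by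
        simp [hN, Derivation.leibniz_pow, hDx v hv, hDz v hv, hvb, hvw]
      rw [Derivation.leibniz, hvc, hDN, smul_zero, smul_zero, add_zero]

/-- If a minor of `Q` has a nonzero component that is linear in the label weights of `S`, then the
rows and columns of the minor are joined by a routing through `S`. -/
theorem exists_isRouting_of_minor_ne_zero [Fintype ι] [DecidableEq ι] [CharP R 2] {K M : Type*}
    [CommRing K] [Algebra K R] [AddCommGroup M]
    {x : V → V → R} (hx : ∀ v w, x v w = x w v) (hx0 : ∀ v, x v v = 0)
    {z : V → R} (hz : ∀ v, z v ^ 2 = 0) {Q : Matrix V V R} (hQ : walkMatrix x z * Q = 1)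
    {S : Set V} (D : V → Derivation K R R) (hDx : ∀ v ∈ S, ∀ u w, D v (x u w) = 0)
    (hDz : ∀ v ∈ S, ∀ w, D v (z w) = if w = v then z v else 0)
    (φ : R →+ M) (hφ : ∀ v ∈ S, ∀ f, φ (D v f) = φ f) {s t : ι → V}
    (ht : Function.Injective t) (hne : φ (Q.submatrix s t).det ≠ 0) :
    ∃ (A : Finset V) (g : V → V), IsRouting x s t A g ∧ S ⊆ A := by
  classical
  let g : V → V := Function.extend t s id
  have hg : ∀ j, g (t j) = s j := fun j => ht.extend_apply _ _ _
  have hT : ∀ v, v ∈ Finset.univ.image t ↔ ∃ j, t j = v := by simp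
  have hq : Q.det * (walkMatrix x z).det = 1 := by
    rw [← det_mul, mul_eq_one_comm.mp hQ, det_one]
  refine exists_isRouting_of_replaceRows_ne_zero hx hx0 hz hq D hDx hDz φ hφ
    (Finset.univ.image t) g ⟨by simp, hg, ?_, ?_⟩ 1 (fun v _ _ _ => (D v).map_one_eq_zero) ?_
  · intro a ha hne'
    obtain ⟨j, hj⟩ := (hT a).mp ha
    exact absurd hj (hne' j)
  · intro B _ hB _ a ha
    obtain ⟨j, rfl⟩ := (hT a).mp ha
    exact hB j
  · rwa [mul_one, mul_comm, ← det_minor_eq_det_replaceRows_mul hQ s t ht g hg hT]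

end Routing

/-! ### Polynomials truncated at a monomial -/

section Truncation

open MvPolynomial

variable {σ : Type*} (K : Type*) [Field K] (m : σ →₀ ℕ)

/-- The ideal generated by the monomials that do not divide the monomial with exponent `m`. -/
noncomputable def truncIdeal : Ideal (MvPolynomial σ K) :=
  Ideal.span ((fun s => monomial s (1 : K)) '' {s | ¬ s ≤ m})

variable {K m} in
theorem mem_truncIdeal_iff {p : MvPolynomial σ K} :
    p ∈ truncIdeal K m ↔ ∀ s ∈ p.support, ¬ s ≤ m := by
  rw [truncIdeal, mem_ideal_span_monomial_image]
  refine forall₂_congr fun s _ => ⟨?_, fun h => ⟨s, h, le_rfl⟩⟩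
  rintro ⟨i, hi, his⟩ hs
  exact hi (his.trans hs)

/-- The ring of polynomials modulo the monomials that do not divide the monomial with
exponent `m`. -/
abbrev TruncPoly : Type _ := MvPolynomial σ K ⧸ truncIdeal K m

namespace TruncPoly

/-- The projection from the polynomial ring. -/
noncomputable abbrev mk : MvPolynomial σ K →ₐ[K] TruncPoly K m :=
  Ideal.Quotient.mkₐ K (truncIdeal K m)

theorem mk_surjective : Function.Surjective (mk K m) := Ideal.Quotient.mkₐ_surjective K _

variable {K m} in
theorem mk_eq_zero_iff {p : MvPolynomial σ K} : mk K m p = 0 ↔ ∀ s ∈ p.support, ¬ s ≤ m := by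
  rw [← mem_truncIdeal_iff]
  exact Ideal.Quotient.eq_zero_iff_mem

variable {K m} in
theorem mk_monomial_eq_zero {s : σ →₀ ℕ} (hs : ¬ s ≤ m) (a : K) : mk K m (monomial s a) = 0 := by
  classical
  rw [mk_eq_zero_iff]
  intro s' hs'
  rw [Finset.mem_singleton.mp (support_monomial_subset hs')]
  exact hs

instance : Nontrivial (TruncPoly K m) := by
  refine ⟨⟨mk K m 1, 0, fun h => ?_⟩⟩
  rw [mk_eq_zero_iff] at h
  exact h 0 (by simp) zero_le

instance [CharP K 2] : CharP (TruncPoly K m) 2 :=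
  charP_of_injective_algebraMap (algebraMap K (TruncPoly K m)).injective 2

/-- The coefficient at the exponent `m`, which survives the truncation. -/
noncomputable def topCoeff : TruncPoly K m →+ K :=
  AddMonoidHom.liftOfSurjective (mk K m : MvPolynomial σ K →+ TruncPoly K m) (mk_surjective K m)
    ⟨(coeffAddMonoidHom m : MvPolynomial σ K →+ K), fun p hp => by
      have hp : mk K m p = 0 := hp
      rw [mk_eq_zero_iff] at hp
      by_contra h
      exact hp m (mem_support_iff.mpr h) le_rfl⟩

theorem topCoeff_mk (p : MvPolynomial σ K) : topCoeff K m (mk K m p) = coeff m p :=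
  AddMonoidHom.liftOfRightInverse_comp_apply _ _ _ _ p

theorem _root_.MvPolynomial.coeff_X_mul_pderiv (i : σ) (s : σ →₀ ℕ) (p : MvPolynomial σ K) :
    coeff s (X i * pderiv i p) = s i * coeff s p := by
  classical
  induction p using MvPolynomial.induction_on' with
  | monomial u a =>
    rw [X_mul_pderiv_monomial, coeff_smul, coeff_monomial]
    split_ifs with h
    · rw [h, nsmul_eq_mul]
    · simp
  | add p q hp hq => simp only [map_add, mul_add, coeff_add, hp, hq]

variable {K m} in
theorem mk_X_mul_pderiv_eq_zero (i : σ) {p : MvPolynomial σ K} (hp : mk K m p = 0) :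
    mk K m (((X i : MvPolynomial σ K) • pderiv i) p) = 0 := by
  rw [mk_eq_zero_iff] at hp ⊢
  intro s hs
  rw [mem_support_iff, Derivation.smul_apply, smul_eq_mul, coeff_X_mul_pderiv] at hs
  exact hp s (mem_support_iff.mpr (right_ne_zero_of_mul hs))

/-- The Euler derivation `X i * ∂ / ∂ X i`. -/
noncomputable def euler (i : σ) : Derivation K (TruncPoly K m) (TruncPoly K m) :=
  Derivation.liftOfSurjective (mk_surjective K m) (d := (X i : MvPolynomial σ K) • pderiv i)
    fun _ => mk_X_mul_pderiv_eq_zero i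

theorem euler_mk (i : σ) (p : MvPolynomial σ K) :
    euler K m i (mk K m p) = mk K m (X i * pderiv i p) :=
  Derivation.liftOfSurjective_apply (mk_surjective K m)
    (fun _ => mk_X_mul_pderiv_eq_zero (K := K) (m := m) i) p

theorem topCoeff_euler {i : σ} (hi : m i = 1) (f : TruncPoly K m) :
    topCoeff K m (euler K m i f) = topCoeff K m f := by
  obtain ⟨p, rfl⟩ := mk_surjective K m f
  rw [euler_mk, topCoeff_mk, topCoeff_mk, coeff_X_mul_pderiv, hi, Nat.cast_one, one_mul]

theorem map_idealOfVars_pow : ((idealOfVars σ K).map (mk K m)) ^ (m.degree + 1) = ⊥ := by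
  rw [← Ideal.map_pow, Ideal.map_eq_bot_iff_le_ker]
  intro p hp
  rw [mem_pow_idealOfVars_iff] at hp
  rw [RingHom.mem_ker]
  refine mk_eq_zero_iff.mpr fun s hs hsm => ?_
  have h1 := hp s hs
  have h2 := Finsupp.degree_mono hsm
  omega

end TruncPoly

end Truncation

/-! ### Edge and label weights -/

section Weights

open MvPolynomial

variable {V C : Type*} (G : SimpleGraph V) {k : ℕ} (c : V → C)
  (K : Type*) [Field K] (m : WalkVar V C k →₀ ℕ)

open Classical in
/-- The weight of a step of a walk. -/
noncomputable def edgeWeight (v w : V) : TruncPoly K m :=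
  if G.Adj v w then TruncPoly.mk K m (X (.edge s(v, w))) else 0

/-- The factor that a visit with label `r` to the vertex `v` contributes to the monomial of a
walk. -/
noncomputable def labelMonomial (v : V) (r : Fin (k + 1)) : MvPolynomial (WalkVar V C k) K :=
  if r = 0 then 1 else X (.vertex v) * X (.colorLabel (c v) r)

/-- The weight of a label at a vertex. -/
noncomputable def labelWeight (v : V) (r : Fin (k + 1)) : TruncPoly K m :=
  TruncPoly.mk K m (labelMonomial c K v r)

/-- The total weight of the nonzero labels at a vertex. -/
noncomputable def totalLabelWeight (v : V) : TruncPoly K m :=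
  ∑ r ∈ Finset.univ.erase 0, labelWeight c K m v r

theorem sum_labelWeight (v : V) : ∑ r, labelWeight c K m v r = 1 + totalLabelWeight c K m v := by
  rw [totalLabelWeight, ← Finset.add_sum_erase _ _ (Finset.mem_univ 0), labelWeight,
    labelMonomial, if_pos rfl, map_one]

theorem edgeWeight_comm (v w : V) : edgeWeight G K m v w = edgeWeight G K m w v := by
  by_cases h : G.Adj v w
  · rw [edgeWeight, edgeWeight, if_pos h, if_pos h.symm, Sym2.eq_swap]
  · rw [edgeWeight, edgeWeight, if_neg h, if_neg fun h' => h h'.symm]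

theorem edgeWeight_self (v : V) : edgeWeight G K m v v = 0 := by simp [edgeWeight]

variable {G K m} in
theorem of_edgeWeight_ne_zero {v w : V} (h : edgeWeight G K m v w ≠ 0) :
    G.Adj v w ∧ m (.edge s(v, w)) ≠ 0 := by
  classical
  rw [edgeWeight] at h
  split_ifs at h with hadj
  · refine ⟨hadj, fun h0 => h (TruncPoly.mk_monomial_eq_zero (fun hle => ?_) 1)⟩
    have := hle (.edge s(v, w))
    rw [Finsupp.single_eq_same] at this
    omega
  · exact absurd rfl h

theorem edgeWeight_mem (v w : V) :
    edgeWeight G K m v w ∈ (idealOfVars (WalkVar V C k) K).map (TruncPoly.mk K m) := by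
  rw [edgeWeight]
  split_ifs
  · exact Ideal.mem_map_of_mem _ (Ideal.subset_span ⟨_, rfl⟩)
  · exact Ideal.zero_mem _

theorem totalLabelWeight_sq {v : V} (hv : m (.vertex v) ≤ 1) :
    totalLabelWeight c K m v ^ 2 = 0 := by
  have h : ∀ r ∈ Finset.univ.erase (0 : Fin (k + 1)), labelWeight c K m v r =
      TruncPoly.mk K m (X (.vertex v)) * TruncPoly.mk K m (X (.colorLabel (c v) r)) := by
    intro r hr
    rw [labelWeight, labelMonomial, if_neg (Finset.ne_of_mem_erase hr), map_mul]
  rw [totalLabelWeight, Finset.sum_congr rfl h, ← Finset.mul_sum, mul_pow, ← map_pow,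
    X_pow_eq_monomial, TruncPoly.mk_monomial_eq_zero, zero_mul]
  intro hle
  have := hle (.vertex v)
  rw [Finsupp.single_eq_same] at this
  omega

theorem euler_edgeWeight (u v w : V) :
    TruncPoly.euler K m (.vertex u) (edgeWeight G K m v w) = 0 := by
  classical
  rw [edgeWeight]
  split_ifs
  · rw [TruncPoly.euler_mk, pderiv_X_of_ne (by simp), mul_zero, map_zero]
  · exact map_zero _

open Classical in
theorem euler_totalLabelWeight (v w : V) :
    TruncPoly.euler K m (.vertex v) (totalLabelWeight c K m w) =
      if w = v then totalLabelWeight c K m v else 0 := by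
  have h : ∀ r ∈ Finset.univ.erase (0 : Fin (k + 1)),
      TruncPoly.euler K m (.vertex v) (labelWeight c K m w r) =
        if w = v then labelWeight c K m v r else 0 := by
    intro r hr
    rw [labelWeight, labelMonomial, if_neg (Finset.ne_of_mem_erase hr), TruncPoly.euler_mk,
      Derivation.leibniz,
      pderiv_X_of_ne (j := WalkVar.colorLabel (c w) r) (by simp), smul_zero, zero_add]
    split_ifs with hwv
    · rw [hwv, pderiv_X_self, labelWeight, labelMonomial, if_neg (Finset.ne_of_mem_erase hr),
        smul_eq_mul, mul_one]
    · rw [pderiv_X_of_ne (by simpa using hwv), smul_zero, mul_zero, map_zero]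
  rw [totalLabelWeight, map_sum, Finset.sum_congr rfl h]
  split_ifs
  · rfl
  · exact Finset.sum_const_zero

end Weights

/-! ### Walks as lists, and their sums -/

section ListsOfLength

variable {α : Type*} [DecidableEq α]

/-- The lists of length `n` with entries in `S`. -/
def listsOfLength (S : Finset α) : ℕ → Finset (List α)
  | 0 => {[]}
  | n + 1 => (S ×ˢ listsOfLength S n).image fun p => p.1 :: p.2

theorem mem_listsOfLength {S : Finset α} {n : ℕ} {l : List α} :
    l ∈ listsOfLength S n ↔ l.length = n ∧ ∀ a ∈ l, a ∈ S := by
  induction n generalizing l with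
  | zero =>
    rw [listsOfLength, Finset.mem_singleton, List.length_eq_zero_iff]
    refine ⟨?_, And.left⟩
    rintro rfl
    simp
  | succ n ih =>
    cases l with
    | nil => simp [listsOfLength]
    | cons a l =>
      simp [listsOfLength, ih]
      tauto

theorem sum_listsOfLength_succ {M : Type*} [AddCommMonoid M] (S : Finset α) (n : ℕ)
    (f : List α → M) :
    ∑ l ∈ listsOfLength S (n + 1), f l = ∑ a ∈ S, ∑ l ∈ listsOfLength S n, f (a :: l) := by
  rw [listsOfLength, Finset.sum_image, Finset.sum_product]
  rintro ⟨a, l⟩ _ ⟨a', l'⟩ _ h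
  simpa using h

/-- The lists of length at most `n` with entries in `S`. -/
def listsOfLengthLE (S : Finset α) (n : ℕ) : Finset (List α) :=
  (Finset.range (n + 1)).biUnion (listsOfLength S)

theorem mem_listsOfLengthLE {S : Finset α} {n : ℕ} {l : List α} :
    l ∈ listsOfLengthLE S n ↔ l.length ≤ n ∧ ∀ a ∈ l, a ∈ S := by
  simp [listsOfLengthLE, mem_listsOfLength]

theorem sum_listsOfLengthLE {M : Type*} [AddCommMonoid M] (S : Finset α) (n : ℕ)
    (f : List α → M) :
    ∑ l ∈ listsOfLengthLE S n, f l = ∑ i ∈ Finset.range (n + 1), ∑ l ∈ listsOfLength S i, f l := by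
  refine Finset.sum_biUnion fun i _ j _ hij => ?_
  refine Finset.disjoint_left.mpr fun l hi hj => hij ?_
  rw [← (mem_listsOfLength.mp hi).1, (mem_listsOfLength.mp hj).1]

end ListsOfLength

section WalkLists

open MvPolynomial

variable {V C : Type*} (G : SimpleGraph V) {k : ℕ} (c : V → C) (K : Type*) [Field K]

/-- No labeled inner entry of the list lies between two entries with the same vertex. -/
def NoLabeledDigon : List (V × Fin (k + 1)) → Prop
  | a :: b :: d :: l => ¬ (b.2 ≠ 0 ∧ a.1 = d.1) ∧ NoLabeledDigon (b :: d :: l)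
  | _ => True

theorem noLabeledDigon_congr_head {v : V} {r r' : Fin (k + 1)} {l : List (V × Fin (k + 1))} :
    NoLabeledDigon ((v, r) :: l) ↔ NoLabeledDigon ((v, r') :: l) := by
  rcases l with _ | ⟨b, _ | ⟨d, l⟩⟩ <;> simp [NoLabeledDigon]

theorem noLabeledDigon_iff (l : List (V × Fin (k + 1))) :
    NoLabeledDigon l ↔ ∀ i (h : i + 2 < l.length),
      ¬ ((l[i + 1]).2 ≠ 0 ∧ (l[i]).1 = (l[i + 2]).1) := by
  induction l with
  | nil => simp [NoLabeledDigon]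
  | cons a l ih =>
    rcases l with _ | ⟨b, _ | ⟨d, l⟩⟩
    · simp [NoLabeledDigon]
    · simp [NoLabeledDigon]
    · rw [NoLabeledDigon, ih]
      constructor
      · rintro ⟨h0, h⟩ (_ | i) hi
        · exact h0
        · exact h i (by simpa using hi)
      · intro h
        exact ⟨h 0 (by simp), fun i hi => h (i + 1) (by simpa using hi)⟩

theorem LabeledWalk.forall_not_isLabeledDigon_iff {G : SimpleGraph V} (w : LabeledWalk G k) :
    (∀ i, ¬ w.IsLabeledDigon i) ↔ NoLabeledDigon w.entries := by
  rw [noLabeledDigon_iff]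
  constructor
  · rintro h i hi ⟨h1, h2⟩
    exact h (i + 1) ⟨⟨Nat.succ_pos i, hi, h2⟩, by omega, h1⟩
  · rintro h (_ | i) ⟨⟨h0, h1, h2⟩, h3, h4⟩
    · exact absurd h0 (lt_irrefl 0)
    · exact h i h1 ⟨h4, h2⟩

/-- The monomial of a walk, by recursion on its entries. -/
noncomputable def entriesMonomial : List (V × Fin (k + 1)) → MvPolynomial (WalkVar V C k) K
  | [] => 1
  | [a] => labelMonomial c K a.1 a.2
  | a :: b :: l =>
    labelMonomial c K a.1 a.2 * X (.edge s(a.1, b.1)) * entriesMonomial (b :: l)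

theorem LabeledWalk.monomial_eq_entriesMonomial {G : SimpleGraph V} (w : LabeledWalk G k) :
    w.monomial K c = entriesMonomial c K w.entries := by
  obtain ⟨l, hl⟩ := w
  rw [LabeledWalk.monomial, LabeledWalk.edgeList, LabeledWalk.vertices,
    LabeledWalk.labeledEntries]
  dsimp only
  clear hl
  induction l with
  | nil => simp [entriesMonomial]
  | cons a l ih =>
    have hlab : ∀ l' : List (V × Fin (k + 1)),
        (((a :: l').filter (fun x => x.2 ≠ 0)).map (fun x => (X (WalkVar.vertex x.1) *
          X (WalkVar.colorLabel (c x.1) x.2) : MvPolynomial (WalkVar V C k) K))).prod =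
        labelMonomial c K a.1 a.2 * ((l'.filter (fun x => x.2 ≠ 0)).map (fun x =>
          (X (WalkVar.vertex x.1) * X (WalkVar.colorLabel (c x.1) x.2) :
            MvPolynomial (WalkVar V C k) K))).prod := by
      intro l'
      by_cases h : a.2 = 0 <;> simp [labelMonomial, h]
    rw [hlab]
    rcases l with _ | ⟨b, l⟩
    · simp [entriesMonomial]
    · rw [entriesMonomial, ← ih]
      simp only [List.map_cons, List.tail_cons, List.zipWith_cons_cons, List.prod_cons]
      ring

theorem exists_labelMonomial_eq (v : V) (r : Fin (k + 1)) :
    ∃ s, labelMonomial c K v r = monomial s 1 := by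
  rw [labelMonomial]
  split_ifs
  · exact ⟨0, rfl⟩
  · exact ⟨Finsupp.single _ 1 + Finsupp.single _ 1, by rw [X, X, monomial_mul, one_mul]⟩

/-- The monomial of a walk has degree at least its number of steps. -/
theorem exists_entriesMonomial_eq (l : List (V × Fin (k + 1))) :
    ∃ s : WalkVar V C k →₀ ℕ, entriesMonomial c K l = monomial s 1 ∧ l.length ≤ s.degree + 1 := by
  induction l with
  | nil => exact ⟨0, rfl, by simp⟩
  | cons a l ih =>
    obtain ⟨s, hs⟩ := exists_labelMonomial_eq c K a.1 a.2
    rcases l with _ | ⟨b, l⟩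
    · exact ⟨s, hs, by simp⟩
    · obtain ⟨s', hs', hl⟩ := ih
      refine ⟨s + Finsupp.single (.edge s(a.1, b.1)) 1 + s', ?_, ?_⟩
      · rw [entriesMonomial, hs, hs', X, monomial_mul, monomial_mul, one_mul, one_mul]
      · rw [map_add, map_add, Finsupp.degree_single, List.length_cons]
        omega

/-- The list is the list of entries of a walk without labeled digons from `v` to `t`. -/
structure IsDigonFreeWalk (v t : V) (l : List (V × Fin (k + 1))) : Prop where
  isChain : l.IsChain (fun x y => G.Adj x.1 y.1)
  noLabeledDigon : NoLabeledDigon l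
  head : (l.map Prod.fst).head? = some v
  last : (l.map Prod.fst).getLast? = some t

/-- The list is the list of entries of a walk to `t` that, preceded by an unlabeled visit to `u`,
has no labeled digons. -/
def IsTail (u t : V) (l : List (V × Fin (k + 1))) : Prop :=
  l.IsChain (fun x y => G.Adj x.1 y.1) ∧ NoLabeledDigon ((u, 0) :: l) ∧
    (l.map Prod.fst).getLast? = some t

variable {G} in
theorem isTail_cons_cons {u t : V} {a b : V × Fin (k + 1)} {l : List (V × Fin (k + 1))} :
    IsTail G u t (a :: b :: l) ↔
      G.Adj a.1 b.1 ∧ ¬ (a.2 ≠ 0 ∧ u = b.1) ∧ IsTail G a.1 t (b :: l) := by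
  have h : NoLabeledDigon (a :: b :: l) ↔ NoLabeledDigon ((a.1, 0) :: b :: l) :=
    noLabeledDigon_congr_head
  rw [IsTail, IsTail, List.isChain_cons_cons, NoLabeledDigon, h, List.map_cons, List.map_cons,
    List.getLast?_cons_cons]
  tauto

variable {G} in
theorem isDigonFreeWalk_cons_cons {v t : V} {a b : V × Fin (k + 1)}
    {l : List (V × Fin (k + 1))} :
    IsDigonFreeWalk G v t (a :: b :: l) ↔ a.1 = v ∧ G.Adj a.1 b.1 ∧ IsTail G a.1 t (b :: l) := by
  have h : NoLabeledDigon (a :: b :: l) ↔ NoLabeledDigon ((a.1, 0) :: b :: l) :=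
    noLabeledDigon_congr_head
  constructor
  · rintro ⟨h1, h2, h3, h4⟩
    rw [List.isChain_cons_cons] at h1
    rw [List.map_cons, List.map_cons, List.getLast?_cons_cons] at h4
    exact ⟨by simpa using h3, h1.1, h1.2, h.mp h2, h4⟩
  · rintro ⟨h1, h2, h3, h4, h5⟩
    refine ⟨List.isChain_cons_cons.mpr ⟨h2, h3⟩, h.mpr h4, by simpa using h1, ?_⟩
    rwa [List.map_cons, List.map_cons, List.getLast?_cons_cons]

variable (m : WalkVar V C k →₀ ℕ)

open Classical in
/-- The weight of a list of entries as a walk to `t` that is preceded by the vertex `u`. -/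
noncomputable def tailWeight (u t : V) (l : List (V × Fin (k + 1))) : TruncPoly K m :=
  if IsTail G u t l then TruncPoly.mk K m (entriesMonomial c K l) else 0

open Classical in
theorem tailWeight_singleton (u t : V) (a : V × Fin (k + 1)) :
    tailWeight G c K m u t [a] = if a.1 = t then labelWeight c K m a.1 a.2 else 0 := by
  simp [tailWeight, IsTail, NoLabeledDigon, entriesMonomial, labelWeight]

open Classical in
theorem tailWeight_cons_cons (u t : V) (a b : V × Fin (k + 1)) (l : List (V × Fin (k + 1))) :
    tailWeight G c K m u t (a :: b :: l) = edgeWeight G K m a.1 b.1 *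
      (if a.2 ≠ 0 ∧ u = b.1 then 0 else labelWeight c K m a.1 a.2) *
        tailWeight G c K m a.1 t (b :: l) := by
  rw [tailWeight, tailWeight, isTail_cons_cons, edgeWeight, labelWeight, entriesMonomial, map_mul,
    map_mul]
  by_cases h : G.Adj a.1 b.1 ∧ ¬ (a.2 ≠ 0 ∧ u = b.1) ∧ IsTail G a.1 t (b :: l)
  · rw [if_pos h, if_pos h.1, if_neg h.2.1, if_pos h.2.2]
    ring
  · rw [if_neg h]
    by_cases hadj : G.Adj a.1 b.1
    · by_cases hd : a.2 ≠ 0 ∧ u = b.1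
      · rw [if_pos hd, mul_zero, zero_mul]
      · rw [if_neg fun hl => h ⟨hadj, hd, hl⟩, mul_zero]
    · rw [if_neg hadj, zero_mul, zero_mul]

/-- The weight of a list of entries as a walk from `v` to `t`. -/
noncomputable def walkWeight (v t : V) (l : List (V × Fin (k + 1))) : TruncPoly K m :=
  open Classical in
  if IsDigonFreeWalk G v t l then TruncPoly.mk K m (entriesMonomial c K l) else 0

theorem walkWeight_nil (v t : V) : walkWeight G c K m v t [] = 0 := by
  rw [walkWeight, if_neg]
  rintro ⟨-, -, h, -⟩
  simp at h

open Classical in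
theorem walkWeight_singleton (v t : V) (a : V × Fin (k + 1)) :
    walkWeight G c K m v t [a] =
      if a.1 = v then if v = t then labelWeight c K m v a.2 else 0 else 0 := by
  have h : IsDigonFreeWalk G v t [a] ↔ a.1 = v ∧ v = t := by
    constructor
    · rintro ⟨-, -, h1, h2⟩
      have h1 : a.1 = v := by simpa using h1
      have h2 : a.1 = t := by simpa using h2
      exact ⟨h1, h1 ▸ h2⟩
    · rintro ⟨rfl, rfl⟩
      exact ⟨by simp, by simp [NoLabeledDigon], rfl, rfl⟩
  rw [walkWeight, h]
  by_cases h1 : a.1 = v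
  · subst h1
    simp [entriesMonomial, labelWeight]
  · simp [h1]

open Classical in
theorem walkWeight_cons_cons (v t : V) (a b : V × Fin (k + 1)) (l : List (V × Fin (k + 1))) :
    walkWeight G c K m v t (a :: b :: l) =
      if a.1 = v then edgeWeight G K m v b.1 * labelWeight c K m v a.2 *
        tailWeight G c K m v t (b :: l) else 0 := by
  rw [walkWeight, isDigonFreeWalk_cons_cons, tailWeight, edgeWeight, labelWeight, entriesMonomial,
    map_mul, map_mul]
  by_cases hv : a.1 = v
  · subst hv
    by_cases hadj : G.Adj a.1 b.1 <;> by_cases hl : IsTail G a.1 t (b :: l) <;>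
      simp only [hadj, hl, and_self, and_true, and_false, if_true, if_false, mul_zero, zero_mul]
    ring
  · simp only [hv, false_and, if_false]

variable [DecidableEq V] (S : Finset V)

/-- The formal sums over walks are the weighted sums over their lists of entries. -/
theorem walkSum_eq_sum_tailWeight (n : ℕ) (u v t : S) :
    walkSum (fun v w : S => edgeWeight G K m v w) (fun v => totalLabelWeight c K m v) t n u v =
      ∑ r, ∑ l ∈ listsOfLength (S ×ˢ (Finset.univ : Finset (Fin (k + 1)))) n,
        tailWeight G c K m u t ((v, r) :: l) := by
  induction n generalizing u v with
  | zero =>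
    simp only [walkSum, listsOfLength, Finset.sum_singleton, tailWeight_singleton]
    by_cases h : v = t
    · subst h
      simp only [if_true, sum_labelWeight]
    · have h' : (v : V) ≠ t := fun e => h (Subtype.ext e)
      simp only [h, h', if_false, Finset.sum_const_zero]
  | succ n ih =>
    simp only [walkSum, sum_listsOfLength_succ, Finset.sum_product, tailWeight_cons_cons, ih]
    rw [Finset.sum_comm, ← Finset.sum_coe_sort S]
    refine Finset.sum_congr rfl fun w _ => ?_
    have hlab : ∑ r, (if r ≠ 0 ∧ (u : V) = w then 0 else labelWeight c K m v r) =
        1 + if u = w then 0 else totalLabelWeight c K m v := by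
      by_cases h : u = w
      · subst h
        rw [← Finset.add_sum_erase _ _ (Finset.mem_univ 0), if_pos rfl, Finset.sum_eq_zero]
        · simp [labelWeight, labelMonomial]
        · intro r hr
          rw [if_pos ⟨Finset.ne_of_mem_erase hr, rfl⟩]
      · have h' : (u : V) ≠ w := fun e => h (Subtype.ext e)
        simp only [h, h', and_false, if_false, sum_labelWeight]
    rw [← hlab]
    simp only [Finset.mul_sum, Finset.sum_mul]
    exact (Finset.sum_congr rfl fun r' _ => Finset.sum_comm).trans Finset.sum_comm

theorem walkResolvent_eq_sum_walkWeight (D : ℕ) (v t : S) :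
    walkResolvent (fun v w : S => edgeWeight G K m v w) (fun v => totalLabelWeight c K m v) D v t =
      ∑ l ∈ listsOfLengthLE (S ×ˢ (Finset.univ : Finset (Fin (k + 1)))) (D + 1),
        walkWeight G c K m v t l := by
  have hhead : ∀ f : V → Fin (k + 1) → TruncPoly K m,
      ∑ a ∈ S, ∑ r, (if a = v then f a r else 0) = ∑ r, f v r := by
    intro f
    rw [Finset.sum_comm]
    refine Finset.sum_congr rfl fun r _ => ?_
    rw [Finset.sum_ite_eq', if_pos v.2]
  rw [sum_listsOfLengthLE, Finset.sum_range_succ', Finset.sum_range_succ']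
  have h0 : ∑ l ∈ listsOfLength (S ×ˢ (Finset.univ : Finset (Fin (k + 1)))) 0,
      walkWeight G c K m v t l = 0 := by
    rw [listsOfLength, Finset.sum_singleton, walkWeight_nil]
  have h1 : ∑ l ∈ listsOfLength (S ×ˢ (Finset.univ : Finset (Fin (k + 1)))) 1,
      walkWeight G c K m v t l = if v = t then 1 + totalLabelWeight c K m v else 0 := by
    rw [sum_listsOfLength_succ, Finset.sum_product]
    simp only [listsOfLength, Finset.sum_singleton, walkWeight_singleton]
    rw [hhead]
    by_cases h : v = t
    · subst h
      simp only [if_true, sum_labelWeight]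
    · have h' : (v : V) ≠ t := fun e => h (Subtype.ext e)
      simp only [h, h', if_false, Finset.sum_const_zero]
  have h2 : ∀ n, ∑ l ∈ listsOfLength (S ×ˢ (Finset.univ : Finset (Fin (k + 1)))) (n + 1 + 1),
      walkWeight G c K m v t l = ∑ w : S, edgeWeight G K m v w * (1 + totalLabelWeight c K m v) *
        walkSum (fun v w : S => edgeWeight G K m v w) (fun v => totalLabelWeight c K m v)
          t n v w := by
    intro n
    simp only [sum_listsOfLength_succ, Finset.sum_product, walkWeight_cons_cons,
      walkSum_eq_sum_tailWeight]
    have hpull : ∀ (a : V) (r : Fin (k + 1)),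
        (∑ w ∈ S, ∑ r', ∑ l ∈ listsOfLength (S ×ˢ (Finset.univ : Finset (Fin (k + 1)))) n,
          if a = v then edgeWeight G K m v w * labelWeight c K m v r *
            tailWeight G c K m v t ((w, r') :: l) else 0) =
        if a = v then ∑ w ∈ S, ∑ r', ∑ l ∈ listsOfLength (S ×ˢ Finset.univ) n,
          edgeWeight G K m v w * labelWeight c K m v r *
            tailWeight G c K m v t ((w, r') :: l) else 0 := by
      intro a r
      split_ifs
      · rfl
      · simp only [Finset.sum_const_zero]
    simp only [hpull]
    rw [hhead, Finset.sum_comm, ← Finset.sum_coe_sort S]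
    refine Finset.sum_congr rfl fun w _ => ?_
    rw [← sum_labelWeight]
    simp only [Finset.mul_sum, Finset.sum_mul]
    rw [Finset.sum_comm]
    refine Finset.sum_congr rfl fun r' _ => ?_
    rw [Finset.sum_comm]
  rw [h0, h1, add_zero, add_comm, walkResolvent, Matrix.of_apply]
  congr 1
  simp only [h2, Finset.mul_sum]
  exact Finset.sum_comm

end WalkLists

/-! ### Counting tuples of walks modulo two -/

section Counting

open MvPolynomial

variable {V C : Type*} (G : SimpleGraph V) {k : ℕ} (c : V → C) (K : Type*) [Field K]
  (m : WalkVar V C k →₀ ℕ) {p : ℕ}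

/-- The lists are the lists of entries of walks without labeled digons from the sources `s` to the
sinks `t`, in some order, whose monomials multiply to the monomial with exponent `m`. -/
structure IsWalkTuple (s t : Fin p → V) (f : Fin p → List (V × Fin (k + 1))) : Prop where
  exists_perm : ∃ σ : Equiv.Perm (Fin p), ∀ i, IsDigonFreeWalk G (s i) (t (σ i)) (f i)
  prod_eq : ∏ i, entriesMonomial c K (f i) = monomial m 1

theorem topCoeff_prod_walkWeight (s t : Fin p → V)
    (f : Fin p → List (V × Fin (k + 1))) :
    TruncPoly.topCoeff K m (∏ i, walkWeight G c K m (s i) (t i) (f i)) =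
      open Classical in
      if (∀ i, IsDigonFreeWalk G (s i) (t i) (f i)) ∧
        ∏ i, entriesMonomial c K (f i) = monomial m 1 then 1 else 0 := by
  classical
  by_cases h : ∀ i, IsDigonFreeWalk G (s i) (t i) (f i)
  · have h1 : ∏ i, walkWeight G c K m (s i) (t i) (f i) =
        TruncPoly.mk K m (∏ i, entriesMonomial c K (f i)) := by
      rw [map_prod]
      exact Finset.prod_congr rfl fun i _ => if_pos (h i)
    choose e he _ using fun i => exists_entriesMonomial_eq c K (f i)
    have h2 : ∏ i, entriesMonomial c K (f i) = monomial (∑ i, e i) 1 := by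
      rw [monomial_sum_one]
      exact Finset.prod_congr rfl fun i _ => he i
    rw [h1, TruncPoly.topCoeff_mk, h2, coeff_monomial]
    have h3 : (monomial (∑ i, e i) (1 : K) = monomial m 1) ↔ ∑ i, e i = m := by
      rw [monomial_eq_monomial_iff]
      simp
    by_cases h4 : ∑ i, e i = m
    · rw [if_pos h4, if_pos ⟨h, h3.mpr h4⟩]
    · rw [if_neg h4, if_neg fun h' => h4 (h3.mp h'.2)]
  · rw [if_neg fun h' => h h'.1]
    push Not at h
    obtain ⟨i, hi⟩ := h
    rw [Finset.prod_eq_zero (Finset.mem_univ i) (if_neg hi), map_zero]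

variable [DecidableEq V] (S : Finset V)

open Classical in
/-- The tuples of walks with vertices in `S` and a given monomial. -/
noncomputable def walkTuples (s t : Fin p → V) : Finset (Fin p → List (V × Fin (k + 1))) :=
  (Fintype.piFinset fun _ => listsOfLengthLE (S ×ˢ Finset.univ) (m.degree + 2)).filter
    (IsWalkTuple G c K m s t)

/-- A minor of the matrix of walk sums enumerates tuples of walks. -/
theorem topCoeff_det_walkResolvent [CharP K 2] {s t : Fin p → S} (ht : Function.Injective t) :
    TruncPoly.topCoeff K m ((walkResolvent (fun v w : S => edgeWeight G K m v w)
      (fun v => totalLabelWeight c K m v) (m.degree + 1)).submatrix s t).det =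
    ((walkTuples G c K m S (fun i => s i) (fun i => t i)).card : K) := by
  classical
  have hsign : ∀ σ : Equiv.Perm (Fin p), ((Equiv.Perm.sign σ : ℤ) : TruncPoly K m) = 1 := by
    intro σ
    rcases Int.units_eq_one_or (Equiv.Perm.sign σ) with h | h <;> simp [h, CharTwo.neg_eq]
  rw [← Matrix.det_transpose, Matrix.det_apply']
  simp only [Matrix.transpose_apply, Matrix.submatrix_apply, hsign, one_mul,
    walkResolvent_eq_sum_walkWeight, Finset.prod_univ_sum, map_sum]
  rw [Finset.sum_comm, walkTuples, Finset.card_filter, Nat.cast_sum]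
  refine Finset.sum_congr rfl fun f _ => ?_
  simp only [topCoeff_prod_walkWeight G c K m (fun i => (s i : V))]
  by_cases h : IsWalkTuple G c K m (fun i => (s i : V)) (fun i => (t i : V)) f
  · obtain ⟨⟨σ, hσ⟩, hprod⟩ := h
    rw [if_pos ⟨⟨σ, hσ⟩, hprod⟩, Finset.sum_eq_single σ, if_pos ⟨hσ, hprod⟩, Nat.cast_one]
    · intro τ _ hτ
      rw [if_neg]
      rintro ⟨hτ', -⟩
      refine hτ (Equiv.ext fun i => ht (Subtype.ext (Option.some_injective _ ?_)))
      rw [← (hτ' i).last, ← (hσ i).last]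
    · exact fun h => absurd (Finset.mem_univ σ) h
  · rw [if_neg h, Nat.cast_zero]
    exact Finset.sum_eq_zero fun σ _ => if_neg fun h' => h ⟨⟨σ, h'.1⟩, h'.2⟩

/-- If the number of tuples of walks with a given monomial is odd, then some routing along the edges
of the monomial covers its labeled vertices. -/
theorem exists_isRouting_of_card_walkTuples_ne_zero [CharP K 2] (hm : ∀ v, m (.vertex v) ≤ 1)
    {s t : Fin p → S} (ht : Function.Injective t)
    (hne : ((walkTuples G c K m S (fun i => s i) (fun i => t i)).card : K) ≠ 0) :
    ∃ (A : Finset S) (g : S → S), IsRouting (fun v w : S => edgeWeight G K m v w) s t A g ∧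
      {v : S | m (.vertex (v : V)) = 1} ⊆ A := by
  classical
  rw [← topCoeff_det_walkResolvent G c K m S ht] at hne
  have hx : ∀ v w : S, edgeWeight G K m v w = edgeWeight G K m w v :=
    fun v w => edgeWeight_comm G K m v w
  have hx0 : ∀ v : S, edgeWeight G K m v v = 0 := fun v => edgeWeight_self G K m v
  have hz : ∀ v : S, totalLabelWeight c K m (v : V) ^ 2 = 0 :=
    fun v => totalLabelWeight_sq c K m (hm v)
  refine exists_isRouting_of_minor_ne_zero hx hx0 hz
    (walkMatrix_mul_walkResolvent hx hx0 hz (fun v w => edgeWeight_mem G K m v w)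
      (TruncPoly.map_idealOfVars_pow K m))
    (fun v => TruncPoly.euler K m (.vertex (v : V))) (fun v _ u w => euler_edgeWeight G K m v u w)
    (fun v _ w => ?_) (TruncPoly.topCoeff K m) (fun v hv => TruncPoly.topCoeff_euler K m hv) ht hne
  rw [euler_totalLabelWeight]
  simp only [Subtype.ext_iff]
  split_ifs <;> rfl

end Counting

/-! ### Linkages from routings -/

section RoutingPaths

variable {V R ι : Type*} [DecidableEq V] [CommRing R] [Fintype V] [Finite ι]

/-- Cutting the cycles of a routing at the sinks gives disjoint paths from the sources to the
sinks that cover all vertices of the routing. -/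
theorem IsRouting.exists_paths {x : V → V → R} {s t : ι → V} {A : Finset V} {g : V → V}
    (h : IsRouting x s t A g) (ht : Function.Injective t) :
    ∃ (P : ι → List V) (τ : Equiv.Perm ι), (∀ i, (P i).head? = some (s i)) ∧
      (∀ i, (P i).getLast? = some (t (τ i))) ∧
      (∀ i, (P i).IsChain (fun a b => x a b ≠ 0)) ∧ (∀ i, (P i).Nodup) ∧
      (∀ i j, i ≠ j → (P i).Disjoint (P j)) ∧ ∀ a ∈ A, ∃ i, a ∈ P i := by
  classical
  obtain ⟨σ, hσg, -⟩ := Finset.exists_perm_of_injOn h.mapsTo h.injOn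
  have hσt : ∀ i, σ (t i) = s i := fun i => by rw [hσg _ (h.sink_mem i), h.map_sink]
  have hmem : ∀ i l, (σ ^ l) (s i) ∈ A := by
    intro i l
    induction l with
    | zero =>
      rw [pow_zero, Equiv.Perm.one_apply, ← hσt, hσg _ (h.sink_mem i)]
      exact h.mapsTo _ (h.sink_mem i)
    | succ l ih =>
      rw [pow_succ', Equiv.Perm.mul_apply, hσg _ ih]
      exact h.mapsTo _ ih
  have hex : ∀ i, ∃ l, ∃ j, t j = (σ ^ l) (s i) := by
    intro i
    refine ⟨orderOf σ - 1, i, ?_⟩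
    rw [← hσt, ← Equiv.Perm.mul_apply, ← pow_succ, Nat.sub_add_cancel (orderOf_pos σ),
      pow_orderOf_eq_one, Equiv.Perm.one_apply]
  let N : ι → ℕ := fun i => Nat.find (hex i)
  have hN : ∀ i, ∃ j, t j = (σ ^ N i) (s i) := fun i => Nat.find_spec (hex i)
  have hNmin : ∀ i l, l < N i → ∀ j, t j ≠ (σ ^ l) (s i) := fun i l hl j hj =>
    Nat.find_min (hex i) hl ⟨j, hj⟩
  have hs : Function.Injective s := fun i j e => ht (σ.injective (by rw [hσt, hσt, e]))
  -- A path can be entered only at its source, since its vertices before the last are not sinks.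
  have hkey' : ∀ i j l d, l + d ≤ N j → (σ ^ l) (s i) = (σ ^ (l + d)) (s j) → i = j ∧ d = 0 := by
    intro i j l d hd he
    rw [pow_add, Equiv.Perm.mul_apply] at he
    have he := (σ ^ l).injective he
    rcases d with _ | d
    · exact ⟨hs (by simpa using he), rfl⟩
    · rw [pow_succ', Equiv.Perm.mul_apply, ← hσt i] at he
      exact absurd (σ.injective he) (hNmin j d (by omega) i)
  have hkey : ∀ i j l l', l ≤ N i → l' ≤ N j → (σ ^ l) (s i) = (σ ^ l') (s j) →
      i = j ∧ l = l' := by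
    intro i j l l' hl hl' he
    rcases le_total l l' with hle | hle
    · obtain ⟨d, rfl⟩ := Nat.exists_eq_add_of_le hle
      obtain ⟨h1, rfl⟩ := hkey' i j l d hl' he
      exact ⟨h1, rfl⟩
    · obtain ⟨d, rfl⟩ := Nat.exists_eq_add_of_le hle
      obtain ⟨h1, rfl⟩ := hkey' j i l' d hl he.symm
      exact ⟨h1.symm, rfl⟩
  choose τ hτ using hN
  have hτi : Function.Injective τ := fun i j e =>
    (hkey i j _ _ le_rfl le_rfl (by rw [← hτ, ← hτ, e])).1
  let P : ι → List V := fun i => (List.range (N i + 1)).map fun l => (σ ^ l) (s i)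
  have hP : ∀ i a, a ∈ P i ↔ ∃ l ≤ N i, (σ ^ l) (s i) = a := by
    intro i a
    simp [P]
  refine ⟨P, Equiv.ofBijective τ (Finite.injective_iff_bijective.mp hτi), fun i => ?_, fun i => ?_,
    fun i => ?_, fun i => ?_, fun i j hij a hai haj => ?_, fun a ha => ?_⟩
  · simp [P, List.range_succ_eq_map]
  · simp [P, List.range_succ, hτ]
  · rw [List.isChain_iff_getElem]
    intro l hl
    have hl : l < N i := by simpa [P] using hl
    have : x ((σ ^ l) (s i)) ((σ ^ (l + 1)) (s i)) ≠ 0 := by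
      rw [pow_succ', Equiv.Perm.mul_apply, hσg _ (hmem i l)]
      exact h.weight_ne_zero _ (hmem i l) (hNmin i l hl)
    simpa [P] using this
  · refine List.Nodup.map_on (fun l hl l' hl' e => ?_) List.nodup_range
    rw [List.mem_range, Nat.lt_succ_iff] at hl hl'
    exact (hkey i i l l' hl hl' e).2
  · obtain ⟨l, hl, rfl⟩ := (hP i a).mp hai
    obtain ⟨l', hl', he⟩ := (hP j _).mp haj
    exact hij (hkey i j l l' hl hl' he.symm).1
  · have hgen := h.generated (A.filter fun a => ∃ i, a ∈ P i) (Finset.filter_subset _ _)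
      (fun j => ?_) (fun b hb hgb => ?_)
    · exact (Finset.mem_filter.mp (hgen ha)).2
    · obtain ⟨i, rfl⟩ := (Finite.injective_iff_bijective.mp hτi).2 j
      exact Finset.mem_filter.mpr ⟨h.sink_mem _, i, (hP i _).mpr ⟨N i, le_rfl, (hτ i).symm⟩⟩
    · obtain ⟨hbA, i, hbi⟩ := Finset.mem_filter.mp hb
      refine Finset.mem_filter.mpr ⟨hgb, ?_⟩
      rw [← hσg b hbA]
      obtain ⟨l, hl, rfl⟩ := (hP i b).mp hbi
      rcases hl.lt_or_eq with hl | rfl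
      · exact ⟨i, (hP i _).mpr ⟨l + 1, hl, by rw [pow_succ', Equiv.Perm.mul_apply]⟩⟩
      · refine ⟨τ i, (hP _ _).mpr ⟨0, Nat.zero_le _, ?_⟩⟩
        rw [← hτ, hσt, pow_zero, Equiv.Perm.one_apply]

end RoutingPaths

/-! ### Walkages as tuples of walks -/

section OfFn

variable {V C : Type*} {G : SimpleGraph V} {k : ℕ}

theorem List.filterMap_ofFn_eq {α β : Type*} {p : ℕ} {w : Fin p → α} {F : α → Option β}
    {s : Fin p → β} (h : ∀ i, F (w i) = some (s i)) :
    (List.ofFn w).filterMap F = List.ofFn s := by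
  rw [List.ofFn_eq_map, List.ofFn_eq_map, List.filterMap_map, ← List.filterMap_eq_map]
  congr 1
  funext i
  exact h i

namespace LabeledWalkage

theorem start_eq_ofFn {W : LabeledWalkage G k} {p : ℕ} {w : Fin p → LabeledWalk G k}
    {s : Fin p → V} (hw : W.walks = List.ofFn w) (hs : ∀ i, (w i).vertices.head? = some (s i)) :
    W.start = List.ofFn s := by
  rw [start, hw]
  exact List.filterMap_ofFn_eq hs

theorem endTuple_eq_ofFn {W : LabeledWalkage G k} {p : ℕ} {w : Fin p → LabeledWalk G k}
    {t : Fin p → V} (hw : W.walks = List.ofFn w)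
    (ht : ∀ i, (w i).vertices.getLast? = some (t i)) : W.endTuple = List.ofFn t := by
  rw [endTuple, hw]
  exact List.filterMap_ofFn_eq ht

theorem length_start (W : LabeledWalkage G k) : W.start.length = W.walks.length := by
  rw [start, List.length_filterMap_eq_countP, List.countP_eq_length]
  intro w hw
  have := W.nonempty w hw
  rw [LabeledWalk.length, ← List.length_map (f := Prod.fst)] at this
  rw [List.isSome_head?]
  exact fun h => by simp_all [LabeledWalk.vertices]

/-- A walkage whose tuple of starting vertices is `s` is a tuple of walks indexed like `s`. -/
theorem exists_eq_ofFn (W : LabeledWalkage G k) {p : ℕ} (hp : W.start.length = p) :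
    ∃ (w : Fin p → LabeledWalk G k) (s t : Fin p → V), W.walks = List.ofFn w ∧
      (∀ i, (w i).vertices.head? = some (s i)) ∧
      ∀ i, (w i).vertices.getLast? = some (t i) := by
  rw [length_start] at hp
  subst hp
  have hne : ∀ i, (W.walks.get i).vertices ≠ [] := by
    intro i h
    have := W.nonempty (W.walks.get i) (List.get_mem _ _)
    rw [LabeledWalk.length, ← List.length_map (f := Prod.fst)] at this
    rw [LabeledWalk.vertices] at h
    rw [h] at this
    exact absurd this (by simp)
  exact ⟨W.walks.get, fun i => (W.walks.get i).vertices.head (hne i),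
    fun i => (W.walks.get i).vertices.getLast (hne i), (List.ofFn_get _).symm,
    fun i => List.head?_eq_some_head (hne i), fun i => List.getLast?_eq_some_getLast (hne i)⟩

end LabeledWalkage

end OfFn

/-! ### What the monomial of a walkage determines -/

section MonomialData

open MvPolynomial

variable {V C : Type*} {G : SimpleGraph V} {k : ℕ}

namespace LabeledWalkage

/-- The edges of a walkage, with repetitions. -/
def edges (W : LabeledWalkage G k) : List (Sym2 V) := W.walks.flatMap LabeledWalk.edgeList

/-- The variables in the monomial of a walkage, with repetitions. -/
def vars (c : V → C) (W : LabeledWalkage G k) : List (WalkVar V C k) :=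
  W.edges.map .edge ++ (W.labeledEntries.map (fun x => .vertex x.1) ++
    W.labeledEntries.map (fun x => .colorLabel (c x.1) x.2))

theorem monomial_eq_prod_vars (K : Type*) [CommSemiring K] (c : V → C) (W : LabeledWalkage G k) :
    W.monomial K c = ((W.vars c).map X).prod := by
  have h : ∀ l : List (LabeledWalk G k), (l.map (LabeledWalk.monomial K c)).prod =
      ((l.flatMap LabeledWalk.edgeList).map (fun e => X (.edge e))).prod *
        ((l.flatMap LabeledWalk.labeledEntries).map (fun x =>
          X (.vertex x.1) * X (.colorLabel (c x.1) x.2))).prod := by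
    intro l
    induction l with
    | nil => simp
    | cons w l ih =>
      simp only [List.map_cons, List.prod_cons, ih, LabeledWalk.monomial, List.flatMap_cons,
        List.map_append, List.prod_append]
      ring
  rw [monomial, h, vars, edges, labeledEntries, List.map_append, List.map_append, List.prod_append,
    List.prod_append, List.map_map, List.map_map, List.map_map, List.prod_map_mul]
  rfl

theorem _root_.MvPolynomial.prod_map_X_eq_monomial {σ : Type*} [DecidableEq σ] (K : Type*)
    [CommSemiring K] (l : List σ) :
    (l.map X).prod = MvPolynomial.monomial (Multiset.toFinsupp (l : Multiset σ)) (1 : K) := by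
  induction l with
  | nil => simp
  | cons a l ih =>
    rw [List.map_cons, List.prod_cons, ih, ← Multiset.cons_coe, ← Multiset.singleton_add,
      Multiset.toFinsupp_add, Multiset.toFinsupp_singleton, X, monomial_mul, one_mul]

theorem vars_perm_of_monomial_eq {K : Type*} [CommSemiring K] [Nontrivial K] {c : V → C}
    {W W' : LabeledWalkage G k} (h : W.monomial K c = W'.monomial K c) :
    (W.vars c).Perm (W'.vars c) := by
  classical
  rw [monomial_eq_prod_vars, monomial_eq_prod_vars, prod_map_X_eq_monomial,
    prod_map_X_eq_monomial] at h
  exact Multiset.coe_eq_coe.mp (Multiset.toFinsupp.injective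
    (monomial_left_injective (one_ne_zero (α := K)) h))

theorem edges_perm {c : V → C} {W W' : LabeledWalkage G k} (h : (W.vars c).Perm (W'.vars c)) :
    W.edges.Perm W'.edges := by
  let F : WalkVar V C k → Option (Sym2 V) := fun y => match y with
    | .edge e => some e
    | _ => none
  have hF : ∀ U : LabeledWalkage G k, (U.vars c).filterMap F = U.edges := by
    intro U
    simp [vars, F, List.filterMap_map]
  rw [← hF, ← hF]
  exact h.filterMap F

theorem labeledVertices_perm {c : V → C} {W W' : LabeledWalkage G k}
    (h : (W.vars c).Perm (W'.vars c)) :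
    (W.labeledEntries.map Prod.fst).Perm (W'.labeledEntries.map Prod.fst) := by
  let F : WalkVar V C k → Option V := fun y => match y with
    | .vertex v => some v
    | _ => none
  have hF : ∀ U : LabeledWalkage G k,
      (U.vars c).filterMap F = U.labeledEntries.map Prod.fst := by
    intro U
    simp [vars, F, List.filterMap_map]
  rw [← hF, ← hF]
  exact h.filterMap F

theorem labels_perm {c : V → C} {W W' : LabeledWalkage G k}
    (h : (W.vars c).Perm (W'.vars c)) :
    (W.labeledEntries.map Prod.snd).Perm (W'.labeledEntries.map Prod.snd) := by
  let F : WalkVar V C k → Option (Fin (k + 1)) := fun y => match y with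
    | .colorLabel _ r => some r
    | _ => none
  have hF : ∀ U : LabeledWalkage G k,
      (U.vars c).filterMap F = U.labeledEntries.map Prod.snd := by
    intro U
    simp [vars, F, List.filterMap_map]
  rw [← hF, ← hF]
  exact h.filterMap F

theorem collected_eq {c : V → C} {W W' : LabeledWalkage G k} (h : (W.vars c).Perm (W'.vars c)) :
    W.collected = W'.collected := by
  ext v
  have := (labeledVertices_perm h).mem_iff (a := v)
  simpa [collected] using this

theorem edgeSet_eq_setOf_mem_edges (W : LabeledWalkage G k) : W.edgeSet = {e | e ∈ W.edges} := by
  ext e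
  simp [edgeSet, edges]

theorem length_eq_edges_add (W : LabeledWalkage G k) :
    W.length = W.edges.length + W.start.length := by
  have h : ∀ l : List (LabeledWalk G k), (∀ w ∈ l, 1 ≤ w.length) →
      (l.map LabeledWalk.length).sum =
        (l.flatMap LabeledWalk.edgeList).length + l.length := by
    intro l hl
    induction l with
    | nil => rfl
    | cons w l ih =>
      have h1 : w.edgeList.length + 1 = w.length := by
        have := hl w List.mem_cons_self
        rw [LabeledWalk.length] at this
        simp only [LabeledWalk.edgeList, LabeledWalk.vertices, List.length_zipWith,
          List.length_tail, List.length_map, LabeledWalk.length]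
        omega
      rw [List.map_cons, List.sum_cons, ih fun w' hw' => hl w' (List.mem_cons_of_mem _ hw'),
        List.flatMap_cons, List.length_append, List.length_cons]
      omega
  rw [length_start, length, edges, h _ W.nonempty]

theorem IsProper.of_vars_perm {c : V → C} {W W' : LabeledWalkage G k} (hW : W.IsProper c)
    (h : (W.vars c).Perm (W'.vars c))
    (hdigon : ∀ w ∈ W'.walks, ∀ i, ¬ w.IsLabeledDigon i) (hends : W'.endTuple.Nodup) :
    W'.IsProper c where
  injective := (labels_perm h).nodup_iff.mp hW.injective
  no_labeledDigon := hdigon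
  ends_distinct := hends
  colors_distinct := by
    have := (labeledVertices_perm h).length_eq
    rw [List.length_map, List.length_map] at this
    rw [← collected_eq h, hW.colors_distinct, this]

theorem IsBarren.of_vars_perm {c : V → C} {W W' : LabeledWalkage G k} (hW : W.IsBarren)
    (h : (W.vars c).Perm (W'.vars c)) (hstart : W'.start = W.start)
    (hend : W'.endSet = W.endSet) : W'.IsBarren := by
  rintro ⟨L, h1, h2, h3, h4, h5, h6⟩
  refine hW ⟨L, h1, h2.trans hstart, h3.trans hend, h4.trans (collected_eq h).symm, ?_, ?_⟩
  · rwa [length_eq_edges_add W, (edges_perm h).length_eq, ← hstart, ← length_eq_edges_add]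
  · refine h6.trans fun e he => ?_
    rw [edgeSet_eq_setOf_mem_edges] at he ⊢
    exact (edges_perm h).mem_iff.mpr he

theorem IsProper.nodup_labeledVertices {c : V → C} {W : LabeledWalkage G k}
    (hW : W.IsProper c) : (W.labeledEntries.map Prod.fst).Nodup := by
  classical
  have h1 : W.collected = ((W.labeledEntries.map Prod.fst).toFinset : Set V) := by
    ext v
    simp [collected]
  have h2 := hW.colors_distinct
  have h3 : (c '' W.collected).ncard ≤ W.collected.ncard := by
    rw [h1]
    exact Set.ncard_image_le (Finset.finite_toSet _)
  rw [h2, h1, Set.ncard_coe_finset] at h3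
  rw [← Multiset.coe_nodup, ← Multiset.toFinset_card_eq_card_iff_nodup]
  refine le_antisymm (Multiset.toFinset_card_le _) ?_
  simpa using h3

end LabeledWalkage

end MonomialData

/-! ### The parity of the fibers -/

section EdgeLists

variable {V : Type*}

theorem mem_of_mem_zipWith_tail {l : List V} {E : Set (Sym2 V)}
    (h : l.IsChain (fun a b => s(a, b) ∈ E)) {e : Sym2 V}
    (he : e ∈ List.zipWith (fun u v => s(u, v)) l l.tail) : e ∈ E := by
  induction l with
  | nil => simp at he
  | cons a l ih =>
    rcases l with _ | ⟨b, l⟩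
    · simp at he
    · rw [List.isChain_cons_cons] at h
      rw [List.tail_cons, List.zipWith_cons_cons, List.mem_cons] at he
      rcases he with rfl | he
      · exact h.1
      · exact ih h.2 he

theorem mem_of_mem_of_mem_zipWith_tail {l : List V} {e : Sym2 V} {a : V}
    (he : e ∈ List.zipWith (fun u v => s(u, v)) l l.tail) (ha : a ∈ e) : a ∈ l := by
  induction l with
  | nil => simp at he
  | cons b l ih =>
    rcases l with _ | ⟨d, l⟩
    · simp at he
    · rw [List.tail_cons, List.zipWith_cons_cons, List.mem_cons] at he
      rcases he with rfl | he
      · rcases Sym2.mem_iff.mp ha with rfl | rfl <;> simp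
      · exact List.mem_cons_of_mem _ (ih he)

theorem head_or_exists_mem_zipWith_tail {l : List V} {a : V} (ha : a ∈ l) :
    l.head? = some a ∨ ∃ e ∈ List.zipWith (fun u v => s(u, v)) l l.tail, a ∈ e := by
  induction l with
  | nil => simp at ha
  | cons b l ih =>
    rcases List.mem_cons.mp ha with rfl | ha
    · exact Or.inl rfl
    · right
      rcases l with _ | ⟨d, l⟩
      · simp at ha
      · rw [List.tail_cons, List.zipWith_cons_cons]
        rcases ih ha with h | ⟨e, he, hae⟩
        · obtain rfl : d = a := by simpa using h
          exact ⟨_, List.mem_cons_self, Sym2.mem_mk_right _ _⟩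
        · exact ⟨e, List.mem_cons_of_mem _ he, hae⟩

end EdgeLists

namespace LabeledWalkage

open MvPolynomial

variable {V C : Type*} {G : SimpleGraph V} {k : ℕ}

/-- The vertices of a walkage, with repetitions. -/
def vertices (W : LabeledWalkage G k) : List V := W.walks.flatMap LabeledWalk.vertices

theorem length_vertices (W : LabeledWalkage G k) : W.vertices.length = W.length := by
  rw [vertices, List.length_flatMap, length]
  congr 1
  refine List.map_congr_left fun w _ => ?_
  rw [LabeledWalk.vertices, List.length_map, LabeledWalk.length]

theorem mem_collected_iff {W : LabeledWalkage G k} {v : V} :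
    v ∈ W.collected ↔ ∃ r, r ≠ 0 ∧ ∃ w ∈ W.walks, (v, r) ∈ w.entries := by
  simp only [collected, labeledEntries, LabeledWalk.labeledEntries, Set.mem_ofPred_eq,
    List.mem_flatMap, List.mem_filter, decide_eq_true_eq]
  constructor
  · rintro ⟨⟨v, r⟩, ⟨w, hw, hr, h0⟩, rfl⟩
    exact ⟨r, h0, w, hw, hr⟩
  · rintro ⟨r, h0, w, hw, hr⟩
    exact ⟨(v, r), ⟨w, hw, hr, h0⟩, rfl⟩

theorem count_vertex_vars [DecidableEq V] [DecidableEq (WalkVar V C k)] (c : V → C)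
    (W : LabeledWalkage G k) (v : V) :
    (W.vars c).count (.vertex v) = (W.labeledEntries.map Prod.fst).count v := by
  have h1 : W.labeledEntries.map (fun x => (WalkVar.vertex x.1 : WalkVar V C k)) =
      (W.labeledEntries.map Prod.fst).map WalkVar.vertex := by
    rw [List.map_map]
    rfl
  have h2 : (W.edges.map (WalkVar.edge : _ → WalkVar V C k)).count (.vertex v) = 0 :=
    List.count_eq_zero_of_not_mem (by simp)
  have h3 : (W.labeledEntries.map (fun x => (WalkVar.colorLabel (c x.1) x.2 :
      WalkVar V C k))).count (.vertex v) = 0 :=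
    List.count_eq_zero_of_not_mem (by simp)
  rw [vars, List.count_append, List.count_append, h1, h2, h3,
    List.count_map_of_injective _ _ fun a b h => by simpa using h]
  omega

/-- The walkages without labeled digons and with distinct ends that share the monomial, the starts
and the set of ends of `W`. -/
def fiber (K : Type*) [CommSemiring K] (c : V → C) (W : LabeledWalkage G k) :
    Set (LabeledWalkage G k) :=
  {W' | W'.monomial K c = W.monomial K c ∧ W'.start = W.start ∧ W'.endSet = W.endSet ∧
    (∀ w ∈ W'.walks, ∀ i, ¬ w.IsLabeledDigon i) ∧ W'.endTuple.Nodup}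

/-- A routing that covers the collected vertices of `W` along edges of `W` gives a linkage that
shows that `W` is not barren. -/
theorem not_isBarren_of_isRouting {K : Type*} [Field K] (W : LabeledWalkage G k)
    {m : WalkVar V C k →₀ ℕ} (hm : ∀ e, m (.edge e) ≠ 0 → e ∈ W.edges) [DecidableEq V]
    {S : Finset V} (hS : ∀ v, v ∈ S ↔ v ∈ W.vertices) {p : ℕ} {s t : Fin p → S}
    (ht : Function.Injective t) (hstart : W.start = List.ofFn fun i => (s i : V))
    (hend : W.endTuple = List.ofFn fun i => (t i : V)) {A : Finset S} {g : S → S}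
    (hA : IsRouting (fun v w : S => edgeWeight G K m v w) s t A g)
    (hcol : ∀ v : S, (v : V) ∈ W.collected → v ∈ A) : ¬ W.IsBarren := by
  classical
  obtain ⟨P, τ, hhead, hlast, hchain, hnodup, hdisj, hcover⟩ := hA.exists_paths ht
  have hlab : ∃ lab : V → Fin (k + 1), ∀ v, lab v ≠ 0 ↔ v ∈ W.collected := by
    refine ⟨fun v => if h : v ∈ W.collected then (mem_collected_iff.mp h).choose else 0,
      fun v => ?_⟩
    by_cases h : v ∈ W.collected
    · simp only [h, dif_pos, iff_true]
      exact (mem_collected_iff.mp h).choose_spec.1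
    · simp [h]
  obtain ⟨lab, hlab⟩ := hlab
  -- A linkage need not have distinct labels, so the collected vertices may keep labels of `W`.
  let w : Fin p → LabeledWalk G k := fun i =>
    ⟨(P i).map fun v : S => ((v : V), lab v), (List.isChain_map _).mpr
      ((hchain i).imp fun a b h => (of_edgeWeight_ne_zero h).1)⟩
  have hw : ∀ i, (w i).vertices = (P i).map (fun v : S => (v : V)) := fun i => by
    rw [LabeledWalk.vertices, List.map_map]
    rfl
  let L : LabeledWalkage G k := ⟨List.ofFn w, by
    intro w' hw'
    obtain ⟨i, rfl⟩ := (List.mem_ofFn' _ _).mp hw'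
    have := hhead i
    rcases hP : P i with _ | ⟨a, l⟩
    · rw [hP] at this
      simp at this
    · simp [w, hP, LabeledWalk.length]⟩
  have hLw : ∀ w', w' ∈ L.walks ↔ ∃ i, w i = w' := fun w' => List.mem_ofFn' _ _
  have hLnodup : L.IsLinkage := by
    refine List.nodup_flatMap.mpr ⟨fun w' hw' => ?_, List.pairwise_ofFn.mpr fun i j hij => ?_⟩
    · obtain ⟨i, rfl⟩ := (hLw _).mp hw'
      rw [hw]
      exact (hnodup i).map Subtype.val_injective
    · rw [Function.onFun, hw, hw]
      intro a hai haj
      obtain ⟨b, hbi, rfl⟩ := List.mem_map.mp hai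
      obtain ⟨d, hdj, hdb⟩ := List.mem_map.mp haj
      rw [Subtype.val_injective hdb] at hdj
      exact hdisj i j hij.ne hbi hdj
  refine not_not.mpr ⟨L, hLnodup, ?_, ?_, ?_, ?_, ?_⟩
  · rw [hstart]
    exact start_eq_ofFn rfl fun i => by rw [hw, List.head?_map, hhead]; rfl
  · have h : L.endTuple = List.ofFn fun i => (t (τ i) : V) :=
      endTuple_eq_ofFn rfl fun i => by rw [hw, List.getLast?_map, hlast]; rfl
    ext v
    simp only [endSet, h, hend, Set.mem_ofPred_eq, List.mem_ofFn', Set.mem_range]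
    exact ⟨fun ⟨i, hi⟩ => ⟨τ i, hi⟩, fun ⟨i, hi⟩ => ⟨τ.symm i, by rw [τ.apply_symm_apply, hi]⟩⟩
  · ext v
    rw [mem_collected_iff]
    constructor
    · rintro ⟨r, hr, w', hw', hv⟩
      obtain ⟨i, rfl⟩ := (hLw _).mp hw'
      obtain ⟨a, -, ha⟩ := List.mem_map.mp hv
      rw [Prod.mk.injEq] at ha
      rw [← hlab, ← ha.1, ha.2]
      exact hr
    · intro hv
      obtain ⟨r, -, w', hw', hr⟩ := mem_collected_iff.mp hv
      have hvS : v ∈ S := (hS v).mpr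
        (List.mem_flatMap.mpr ⟨w', hw', List.mem_map.mpr ⟨_, hr, rfl⟩⟩)
      obtain ⟨i, hi⟩ := hcover ⟨v, hvS⟩ (hcol ⟨v, hvS⟩ hv)
      exact ⟨lab v, (hlab v).mpr hv, w i, (hLw _).mpr ⟨i, rfl⟩, List.mem_map.mpr ⟨_, hi, rfl⟩⟩
  -- The vertices of a linkage are distinct, so there are at most as many as in `W`.
  · rw [← length_vertices, ← length_vertices]
    refine (List.subperm_of_subset hLnodup fun v hv => ?_).length_le
    obtain ⟨w', hw', hv⟩ := List.mem_flatMap.mp hv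
    obtain ⟨i, rfl⟩ := (hLw _).mp hw'
    rw [hw] at hv
    obtain ⟨a, -, rfl⟩ := List.mem_map.mp hv
    exact (hS a).mp a.2
  · rintro e ⟨w', hw', he⟩
    obtain ⟨i, rfl⟩ := (hLw _).mp hw'
    rw [edgeSet_eq_setOf_mem_edges]
    refine mem_of_mem_zipWith_tail ?_ he
    rw [hw, List.isChain_map]
    exact (hchain i).imp fun a b h => hm _ (of_edgeWeight_ne_zero h).2

/-- The entries of the first `p` walks of a walkage. -/
def entriesTuple (p : ℕ) (W : LabeledWalkage G k) : Fin p → List (V × Fin (k + 1)) :=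
  fun i => ((W.walks.map LabeledWalk.entries)[(i : ℕ)]?).getD []

theorem entriesTuple_eq {W : LabeledWalkage G k} {p : ℕ} {w : Fin p → LabeledWalk G k}
    (hw : W.walks = List.ofFn w) : W.entriesTuple p = fun i => (w i).entries := by
  funext i
  simp [entriesTuple, hw]

theorem monomial_eq_prod_entriesMonomial (K : Type*) [Field K] (c : V → C)
    {W : LabeledWalkage G k} {p : ℕ} {w : Fin p → LabeledWalk G k} (hw : W.walks = List.ofFn w) :
    W.monomial K c = ∏ i, entriesMonomial c K (w i).entries := by
  rw [monomial, hw, List.map_ofFn, List.prod_ofFn]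
  exact Finset.prod_congr rfl fun i _ => LabeledWalk.monomial_eq_entriesMonomial c K (w i)

theorem mem_vertices_of_mem_edges {W : LabeledWalkage G k} {e : Sym2 V} (he : e ∈ W.edges) {a : V}
    (ha : a ∈ e) : a ∈ W.vertices := by
  obtain ⟨w, hw, he⟩ := List.mem_flatMap.mp he
  exact List.mem_flatMap.mpr ⟨w, hw, mem_of_mem_of_mem_zipWith_tail he ha⟩

theorem mem_start_or_exists_mem_edges {W : LabeledWalkage G k} {a : V} (ha : a ∈ W.vertices) :
    a ∈ W.start ∨ ∃ e ∈ W.edges, a ∈ e := by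
  obtain ⟨w, hw, ha⟩ := List.mem_flatMap.mp ha
  rcases head_or_exists_mem_zipWith_tail ha with h | ⟨e, he, hae⟩
  · exact Or.inl (List.mem_filterMap.mpr ⟨w, hw, h⟩)
  · exact Or.inr ⟨e, List.mem_flatMap.mpr ⟨w, hw, he⟩, hae⟩

theorem mem_vertices_of_mem_start {W : LabeledWalkage G k} {a : V} (ha : a ∈ W.start) :
    a ∈ W.vertices := by
  obtain ⟨w, hw, h⟩ := List.mem_filterMap.mp ha
  exact List.mem_flatMap.mpr ⟨w, hw, List.mem_of_head? h⟩

theorem mem_vertices_of_mem_endTuple {W : LabeledWalkage G k} {a : V} (ha : a ∈ W.endTuple) :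
    a ∈ W.vertices := by
  obtain ⟨w, hw, h⟩ := List.mem_filterMap.mp ha
  exact List.mem_flatMap.mpr ⟨w, hw, List.mem_of_getLast? h⟩

/-- The walkages in the fiber of `W` are the tuples of walks counted by `walkTuples`. -/
theorem image_entriesTuple_fiber {K : Type*} [Field K] {c : V → C} {W : LabeledWalkage G k}
    {m : WalkVar V C k →₀ ℕ} (hm : W.monomial K c = MvPolynomial.monomial m 1) [DecidableEq V]
    {S : Finset V} (hS : ∀ v, v ∈ S ↔ v ∈ W.vertices) {p : ℕ} {s t : Fin p → V}
    (ht : Function.Injective t) (hstart : W.start = List.ofFn s) (hend : W.endTuple = List.ofFn t) :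
    entriesTuple p '' W.fiber K c = walkTuples G c K m S s t := by
  classical
  ext f
  simp only [walkTuples, Finset.coe_filter, Fintype.mem_piFinset, mem_listsOfLengthLE,
    Finset.mem_product, Finset.mem_univ, and_true, Set.mem_image, Set.mem_ofPred_eq]
  constructor
  · rintro ⟨W', ⟨hmon, hst, hes, hdig, hnd⟩, rfl⟩
    obtain ⟨w, s', t', hw, hs', ht'⟩ := W'.exists_eq_ofFn (p := p) (by rw [hst, hstart]; simp)
    have hss : s' = s := List.ofFn_injective (by rw [← start_eq_ofFn hw hs', hst, hstart])
    subst hss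
    have hend' := endTuple_eq_ofFn hw ht'
    rw [entriesTuple_eq hw]
    have hprod : ∏ i, entriesMonomial c K (w i).entries = MvPolynomial.monomial m 1 := by
      rw [← monomial_eq_prod_entriesMonomial K c hw, hmon, hm]
    refine ⟨fun i => ⟨?_, fun a ha => ?_⟩, ?_, hprod⟩
    · choose e he hle using fun i => exists_entriesMonomial_eq c K (w i).entries
      have h2 : MvPolynomial.monomial (∑ i, e i) (1 : K) = MvPolynomial.monomial m 1 := by
        rw [← hprod, monomial_sum_one]
        exact Finset.prod_congr rfl fun i _ => (he i).symm
      have h3 : ∑ i, e i = m := monomial_left_injective one_ne_zero h2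
      have h4 : (e i).degree ≤ m.degree := by
        rw [← h3]
        exact Finsupp.degree_mono (Finset.single_le_sum (fun _ _ => zero_le) (Finset.mem_univ i))
      exact (hle i).trans (by omega)
    · rw [hS]
      have hav : a.1 ∈ W'.vertices := List.mem_flatMap.mpr
        ⟨w i, by rw [hw]; exact (List.mem_ofFn' _ _).mpr ⟨i, rfl⟩, List.mem_map.mpr ⟨a, ha, rfl⟩⟩
      rcases mem_start_or_exists_mem_edges hav with h | ⟨e, he, hae⟩
      · rw [hst] at h
        exact mem_vertices_of_mem_start h
      · exact mem_vertices_of_mem_edges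
          ((edges_perm (vars_perm_of_monomial_eq hmon)).mem_iff.mp he) hae
    · have htt : ∀ i, ∃ j, t j = t' i := by
        intro i
        have h : t' i ∈ W'.endSet := by
          rw [endSet, hend']
          exact (List.mem_ofFn' _ _).mpr ⟨i, rfl⟩
        rw [hes, endSet, hend] at h
        exact (List.mem_ofFn' _ _).mp h
      choose τ hτ using htt
      have ht'i : Function.Injective t' := List.nodup_ofFn.mp (hend' ▸ hnd)
      have hτi : Function.Injective τ := fun i j h => ht'i (by rw [← hτ, ← hτ, h])
      refine ⟨Equiv.ofBijective τ (Finite.injective_iff_bijective.mp hτi), fun i =>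
        ⟨(w i).isWalk, ?_, hs' i, ?_⟩⟩
      · refine (LabeledWalk.forall_not_isLabeledDigon_iff (w i)).mp (hdig _ ?_)
        rw [hw]
        exact (List.mem_ofFn' _ _).mpr ⟨i, rfl⟩
      · rw [Equiv.ofBijective_apply, hτ]
        exact ht' i
  · rintro ⟨-, ⟨σ, hσ⟩, hprod⟩
    let w : Fin p → LabeledWalk G k := fun i => ⟨f i, (hσ i).isChain⟩
    let W' : LabeledWalkage G k := ⟨List.ofFn w, by
      intro w' hw'
      obtain ⟨i, rfl⟩ := (List.mem_ofFn' _ _).mp hw'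
      have := (hσ i).head
      rcases hf : f i with _ | ⟨a, l⟩
      · rw [hf] at this
        simp at this
      · simp [w, hf, LabeledWalk.length]⟩
    have hend' : W'.endTuple = List.ofFn (fun i => t (σ i)) :=
      endTuple_eq_ofFn rfl fun i => (hσ i).last
    refine ⟨W', ⟨?_, ?_, ?_, ?_, ?_⟩, entriesTuple_eq (W := W') (w := w) rfl⟩
    · rw [hm, monomial_eq_prod_entriesMonomial K c (w := w) rfl, hprod]
    · rw [hstart]
      exact start_eq_ofFn rfl fun i => (hσ i).head
    · ext v
      simp only [endSet, hend', hend, Set.mem_ofPred_eq, List.mem_ofFn', Set.mem_range]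
      exact ⟨fun ⟨i, hi⟩ => ⟨σ i, hi⟩, fun ⟨i, hi⟩ => ⟨σ.symm i, by rw [σ.apply_symm_apply, hi]⟩⟩
    · intro w' hw'
      obtain ⟨i, rfl⟩ := (List.mem_ofFn' _ _).mp hw'
      exact (LabeledWalk.forall_not_isLabeledDigon_iff _).mpr (hσ i).noLabeledDigon
    · rw [hend']
      exact List.nodup_ofFn.mpr (ht.comp σ.injective)

theorem injOn_entriesTuple_fiber {K : Type*} [CommSemiring K] {c : V → C} {W : LabeledWalkage G k}
    {p : ℕ} (hp : W.start.length = p) : Set.InjOn (entriesTuple p) (W.fiber K c) := by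
  rintro W₁ ⟨-, h₁, -⟩ W₂ ⟨-, h₂, -⟩ h
  obtain ⟨w₁, -, -, hw₁, -⟩ := W₁.exists_eq_ofFn (p := p) (by rw [h₁, hp])
  obtain ⟨w₂, -, -, hw₂, -⟩ := W₂.exists_eq_ofFn (p := p) (by rw [h₂, hp])
  rw [entriesTuple_eq hw₁, entriesTuple_eq hw₂] at h
  refine LabeledWalkage.ext ?_
  rw [hw₁, hw₂]
  congr 1
  funext i
  exact LabeledWalk.ext (congrFun h i)

/-- The fiber of a proper barren walkage is finite and of even size. -/
theorem finite_and_even_ncard_fiber (K : Type*) [Field K] [CharP K 2] {c : V → C}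
    {W : LabeledWalkage G k} (hW : W ∈ properBarren G k c) :
    (W.fiber K c).Finite ∧ Even (W.fiber K c).ncard := by
  classical
  obtain ⟨w, s, t, hw, hs, ht⟩ := W.exists_eq_ofFn (p := W.start.length) rfl
  have hstart := start_eq_ofFn hw hs
  have hend := endTuple_eq_ofFn hw ht
  have hti : Function.Injective t := List.nodup_ofFn.mp (hend ▸ hW.1.ends_distinct)
  let S : Finset V := W.vertices.toFinset
  have hS : ∀ v, v ∈ S ↔ v ∈ W.vertices := fun v => List.mem_toFinset
  let m : WalkVar V C k →₀ ℕ := Multiset.toFinsupp (W.vars c : Multiset (WalkVar V C k))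
  have hmW : W.monomial K c = MvPolynomial.monomial m 1 := by
    rw [monomial_eq_prod_vars, prod_map_X_eq_monomial]
  have hmcount : ∀ y, m y = (W.vars c).count y := fun y => by
    simp [m, Multiset.toFinsupp_apply, Multiset.coe_count]
  have himage := image_entriesTuple_fiber hmW hS hti hstart hend
  have hinj := injOn_entriesTuple_fiber (K := K) (c := c) (W := W) rfl
  have hcard : (W.fiber K c).ncard = (walkTuples G c K m S s t).card := by
    rw [← hinj.ncard_image, himage, Set.ncard_coe_finset]
  refine ⟨Set.Finite.of_finite_image (himage ▸ Finset.finite_toSet _) hinj, ?_⟩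
  rw [hcard]
  by_contra hodd
  rw [even_iff_two_dvd, ← CharP.cast_eq_zero_iff K 2] at hodd
  let s' : Fin W.start.length → S := fun i => ⟨s i, (hS _).mpr (mem_vertices_of_mem_start
    (by rw [hstart]; exact (List.mem_ofFn' _ _).mpr ⟨i, rfl⟩))⟩
  let t' : Fin W.start.length → S := fun i => ⟨t i, (hS _).mpr (mem_vertices_of_mem_endTuple
    (by rw [hend]; exact (List.mem_ofFn' _ _).mpr ⟨i, rfl⟩))⟩
  have ht' : Function.Injective t' := fun i j h => hti (congrArg Subtype.val h)
  have hm1 : ∀ v, m (.vertex v) ≤ 1 := fun v => by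
    rw [hmcount, count_vertex_vars]
    exact List.nodup_iff_count_le_one.mp hW.1.nodup_labeledVertices v
  obtain ⟨A, g, hA, hcol⟩ :=
    exists_isRouting_of_card_walkTuples_ne_zero G c K m S hm1 (s := s') ht' hodd
  refine W.not_isBarren_of_isRouting (fun e he => ?_) hS ht' hstart hend hA (fun v hv => ?_) hW.2
  · rw [hmcount, ← Nat.pos_iff_ne_zero, List.count_pos_iff] at he
    simpa [vars] using he
  · refine hcol ?_
    have h : (v : V) ∈ W.labeledEntries.map Prod.fst := by
      simpa [collected] using hv
    have h' := List.count_pos_iff.mpr h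
    rw [← count_vertex_vars c, ← hmcount] at h'
    exact le_antisymm (hm1 v) h'

theorem mem_properBarren_of_mem_fiber {K : Type*} [CommSemiring K] [Nontrivial K] {c : V → C}
    {W W' : LabeledWalkage G k} (hW : W ∈ properBarren G k c) (hW' : W' ∈ W.fiber K c) :
    W' ∈ properBarren G k c := by
  obtain ⟨h1, h2, h3, h4, h5⟩ := hW'
  have h := (vars_perm_of_monomial_eq h1).symm
  exact ⟨hW.1.of_vars_perm h h4 h5, hW.2.of_vars_perm h h2 h3⟩

end LabeledWalkage

/-! ### Fixed-point-free involutions with prescribed fibers -/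

/-- A finite set of even size has an involution without fixed points. -/
theorem exists_involutive_of_even_card {α : Type*} [Finite α] (h : Even (Nat.card α)) :
    ∃ φ : α → α, ∀ a, φ (φ a) = a ∧ φ a ≠ a := by
  obtain ⟨n, hn⟩ := h
  have e : α ≃ Fin n ⊕ Fin n :=
    (Finite.equivFin α).trans ((finCongr hn).trans finSumFinEquiv.symm)
  refine ⟨fun a => e.symm (e a).swap, fun a => ⟨by simp, fun ha => ?_⟩⟩
  have : (e a).swap = e a := e.symm_apply_eq.mp ha
  rcases hx : e a with x | x <;> rw [hx] at this <;> simp at this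

/-- A map with finite fibers of even size is invariant under an involution without fixed points. -/
theorem exists_involutive_comp_eq_of_even_fibers {α β : Type*} (key : α → β)
    (h : ∀ a, Finite {b // key b = key a} ∧ Even (Nat.card {b // key b = key a})) :
    ∃ φ : α → α, ∀ a, φ (φ a) = a ∧ φ a ≠ a ∧ key (φ a) = key a := by
  have h' : ∀ y : β, ∃ φ : {b // key b = y} → {b // key b = y}, ∀ a, φ (φ a) = a ∧ φ a ≠ a := by
    intro y
    by_cases hy : ∃ a, key a = y
    · obtain ⟨a, rfl⟩ := hy
      have := (h a).1
      exact exists_involutive_of_even_card (h a).2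
    · exact ⟨id, fun a => absurd ⟨a.1, a.2⟩ hy⟩
  choose φ hφ using h'
  refine ⟨fun a => (φ (key a) ⟨a, rfl⟩).1, fun a => ⟨?_, fun ha => ?_, (φ (key a) ⟨a, rfl⟩).2⟩⟩
  · have hcongr : ∀ y (b : {b // key b = y}), (φ (key b.1) ⟨b.1, rfl⟩).1 = (φ y b).1 := by
      rintro y ⟨b, rfl⟩
      rfl
    exact (hcongr _ _).trans (congrArg Subtype.val (hφ _ _).1)
  · exact (hφ (key a) ⟨a, rfl⟩).2 (Subtype.ext ha)

theorem mainTheorem6 {V C K : Type*} [Field K] [CharP K 2]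
    (G : SimpleGraph V) (k : ℕ) (c : V → C) :
    ∃ φ : LabeledWalkage.properBarren G k c → LabeledWalkage.properBarren G k c,
      (∀ W : LabeledWalkage.properBarren G k c,
        φ (φ W) = W ∧
        φ W ≠ W ∧
        (φ W).1.monomial K c = W.1.monomial K c ∧
        (φ W).1.endSet = W.1.endSet ∧
        (φ W).1.start = W.1.start) ∧
      ∀ F : Finset (LabeledWalkage.properBarren G k c), (∀ W ∈ F, φ W ∈ F) →
        ∑ W ∈ F, W.1.monomial K c = 0 := by
  obtain ⟨φ, hφ⟩ := exists_involutive_comp_eq_of_even_fibers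
    (fun W : LabeledWalkage.properBarren G k c =>
      (W.1.monomial K c, W.1.start, W.1.endSet)) fun W => by
    have e : {U : LabeledWalkage.properBarren G k c //
        (U.1.monomial K c, U.1.start, U.1.endSet) = (W.1.monomial K c, W.1.start, W.1.endSet)} ≃
        W.1.fiber K c :=
      { toFun := fun U => ⟨U.1.1, by
          obtain ⟨⟨U, hU⟩, h⟩ := U
          simp only [Prod.mk.injEq] at h
          exact ⟨h.1, h.2.1, h.2.2, hU.1.no_labeledDigon, hU.1.ends_distinct⟩⟩
        invFun := fun U => ⟨⟨U.1, LabeledWalkage.mem_properBarren_of_mem_fiber W.2 U.2⟩, by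
          obtain ⟨U, h1, h2, h3, -⟩ := U
          simp only [h1, h2, h3]⟩
        left_inv := fun U => rfl
        right_inv := fun U => rfl }
    obtain ⟨h1, h2⟩ := LabeledWalkage.finite_and_even_ncard_fiber K W.2
    have := h1.to_subtype
    exact ⟨Finite.of_equiv _ e.symm, by rwa [Nat.card_congr e]⟩
  simp only [Prod.mk.injEq] at hφ
  refine ⟨φ, fun W => ⟨(hφ W).1, (hφ W).2.1, (hφ W).2.2.1, (hφ W).2.2.2.2, (hφ W).2.2.2.1⟩,
    fun F hF => ?_⟩
  refine Finset.sum_involution (fun W _ => φ W) (fun W _ => ?_) (fun W _ _ => (hφ W).2.1)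
    (fun W hW => hF W hW) (fun W _ => (hφ W).1)
  rw [(hφ W).2.2.1]
  exact CharTwo.add_self_eq_zero _
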